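/- A mixed signed, directed graph $G$ has a finite vertex set $V$ and a set of edges, each of which is a signed edge $+ij$ or $-ij$ (loops $i=j$ allowed) or a directed edge $(i,j)$ with $i\ne j$; any subset of $+ij,-ij,(i,j),(j,i)$ may be present. Let $k$ be a field. The monomial of a signed edge $\pm ij$ is $(x_ix_j)^{\pm1}$, that of $(i,j)$ is $x_i^{-1}x_j$, and the edge ring $k[G]\subseteq k[x_v^{\pm1}:v\in V]$ is the $k$-subalgebra generated by the monomials of the edges of $G$. A cycle is a closed walk without repeated vertices or edges (edge directions are ignored; a loop is a cycle, and so are two parallel edges). "Path" below means a sequence of consecutive incident edges, in which vertices and edges may be repeated. A signed graph (possibly with loops, and with both $+ij$ and $-ij$ allowed) satisfies the odd cycle condition if any two cycles $C,C'$ of odd length lie in distinct components, or have a common vertex, or are joined by a path from a vertex of $C$ to a vertex of $C'$ along which the signs alternate. The augmented signed graph $\widetilde G$ is obtained from $G$ by replacing each directed edge $(i,j)$ by a new vertex $t=t_{(i,j)}$ and the two edges $-it$, $+tj$. A path in $G$ is generalized alternating if: (a) its signed edges, after deletion of the directed edges, alternate in sign; (b) a signed edge immediately before (after) a directed edge that is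 traversed from tail to head is positive (negative); (c) a signed edge immediately before (after) a directed edge that is traversed from head to tail is negative (positive); (d) between two directed edges that point in opposite directions along the path there is an odd number of signed edges, and between two that point in the same direction an even number. $G$ satisfies the generalized odd cycle condition if any two cycles $C,C'$ of $G$, each with an odd number of signed edges, lie in distinct components, or have a common vertex, or are joined by a generalized alternating path from a vertex of $C$ to a vertex of $C'$. Theorem. (1) For every mixed signed, directed graph $G$ and every field $k$, the following are equivalent: $k[G]$ is normal; $\widetilde G$ satisfies the odd cycle condition; $G$ satisfies the generalized odd cycle condition. (2) Let $R$ be a $k$-subalgebra of $k[x_v^{\pm1}:v\in V]$ generated by monomials of the forms $x_ix_j$, $x_i^{-1}x_j^{-1}$, $x_i^{-1}x_j$, and let $G_R$ be the mixed signed, directed graph on $V$ that has an edge for each such monomial $\neq 1$ in $R$. Then $R=k[G_R]$; in particular $R$ is normal if and only if $\widetilde{G_R}$ satisfies the odd cycle condition, if and only if $G_R$ satisfies the generalized odd cycle condition. -/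

import Mathlib

noncomputable section

/-! ### Signed graphs and mixed signed, directed graphs -/

/-- The possible edges of a mixed signed, directed graph on `V`: a signed edge `+ij` or `-ij`
(a loop if `i = j`), or a directed edge `(i, j)`. -/
inductive MixedEdge (V : Type*) : Type _
  | signed (σ : ℤˣ) (e : Sym2 V) : MixedEdge V
  | directed (i j : V) : MixedEdge V

/-- A signed graph on `V`: an edge `(σ, s(i, j))` is the edge `ij` with sign `σ = ±1`. Loops are
allowed, and `+ij` and `-ij` may both be present. -/
structure SignedGraph (V : Type*) where
  edges : Set (ℤˣ × Sym2 V)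

/-- A mixed signed, directed graph on `V`. Positive and negative loops are allowed, directed loops
are not; any subset of `+ij`, `-ij`, `(i, j)`, `(j, i)` may be present when `i ≠ j`. -/
structure MixedGraph (V : Type*) where
  edges : Set (MixedEdge V)
  not_directed_loop : ∀ i : V, MixedEdge.directed i i ∉ edges

/-- The (unordered) end points of an edge of a mixed graph. -/
def MixedEdge.ends {V : Type*} : MixedEdge V → Sym2 V
  | .signed _ e => e
  | .directed i j => s(i, j)

/-- The edge carries a sign, that is, it is not a directed edge. -/
def MixedEdge.IsSigned {V : Type*} : MixedEdge V → Prop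
  | .signed _ _ => True
  | .directed _ _ => False

/-- The sign of a signed edge; `none` for a directed edge. -/
def MixedEdge.sign? {V : Type*} : MixedEdge V → Option ℤˣ
  | .signed σ _ => some σ
  | .directed _ _ => none

/-! ### Walks, cycles and components (directions of edges play no role) -/

/-- One step of a walk: the edge `edge` is traversed from `src` to `tgt`. -/
structure EdgeStep (V E : Type*) where
  src : V
  edge : E
  tgt : V

/-- `IsEdgeWalk ends S u P v`: the list of steps `P` is a walk from `u` to `v` along edges in `S`,
where `ends e` is the pair of end points of `e`. Vertices and edges may be repeated. -/
def IsEdgeWalk {V E : Type*} (ends : E → Sym2 V) (S : Set E) :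
    V → List (EdgeStep V E) → V → Prop
  | u, [], v => u = v
  | u, s :: P, v =>
      s.src = u ∧ s.edge ∈ S ∧ ends s.edge = s(s.src, s.tgt) ∧ IsEdgeWalk ends S s.tgt P v

/-- `u` and `v` lie in the same component. -/
def EdgeConnected {V E : Type*} (ends : E → Sym2 V) (S : Set E) (u v : V) : Prop :=
  ∃ P : List (EdgeStep V E), IsEdgeWalk ends S u P v

/-- `C` runs once around a cycle, starting and ending at `u`: a nonempty closed walk with no
repeated vertex and no repeated edge. A loop is a cycle of length one, two parallel edges form a
cycle of length two. -/
def IsEdgeCycle {V E : Type*} (ends : E → Sym2 V) (S : Set E) (u : V)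
    (C : List (EdgeStep V E)) : Prop :=
  C ≠ [] ∧ IsEdgeWalk ends S u C u ∧
    (C.map EdgeStep.src).Nodup ∧ (C.map EdgeStep.edge).Nodup

/-- The vertices of a cycle. -/
def cycleVertices {V E : Type*} (C : List (EdgeStep V E)) : Set V :=
  {v | v ∈ C.map EdgeStep.src}

/-! ### The odd cycle condition for signed graphs -/

/-- The signs alternate along the sequence of edges `P`. -/
def IsSignAlternating {V : Type*} (P : List (EdgeStep V (ℤˣ × Sym2 V))) : Prop :=
  (P.map fun s => s.edge.1).IsChain (· ≠ ·)

/-- The odd cycle condition: any two cycles of odd length are in distinct components, have a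
vertex in common, or are joined by a sign alternating path. -/
def SignedGraph.OddCycleCondition {V : Type*} (G : SignedGraph V) : Prop :=
  ∀ (u u' : V) (C C' : List (EdgeStep V (ℤˣ × Sym2 V))),
    IsEdgeCycle Prod.snd G.edges u C → IsEdgeCycle Prod.snd G.edges u' C' →
    Odd C.length → Odd C'.length →
      ¬ EdgeConnected Prod.snd G.edges u u' ∨
      (cycleVertices C ∩ cycleVertices C').Nonempty ∨
      ∃ i ∈ cycleVertices C, ∃ j ∈ cycleVertices C', ∃ P : List (EdgeStep V (ℤˣ × Sym2 V)),
        IsEdgeWalk Prod.snd G.edges i P j ∧ IsSignAlternating P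

/-! ### The augmented signed graph -/

/-- The vertices of the augmented signed graph: those of `G`, and an artificial vertex
`t_{(i, j)}` for every directed edge `(i, j)` of `G`. -/
abbrev MixedGraph.AugVertex {V : Type*} (G : MixedGraph V) : Type _ :=
  V ⊕ {p : V × V // MixedEdge.directed p.1 p.2 ∈ G.edges}

/-- The augmented signed graph of `G`: the signed edges of `G` are kept, and each directed edge
`(i, j)` is replaced by the two edges `-it` and `+tj`, where `t = t_{(i, j)}`. -/
def MixedGraph.augmented {V : Type*} (G : MixedGraph V) : SignedGraph G.AugVertex where
  edges :=
    {x | ∃ (σ : ℤˣ) (e : Sym2 V), MixedEdge.signed σ e ∈ G.edges ∧ x = (σ, e.map Sum.inl)} ∪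
    {x | ∃ t : {p : V × V // MixedEdge.directed p.1 p.2 ∈ G.edges},
      x = (-1, s(Sum.inl t.1.1, Sum.inr t)) ∨ x = (1, s(Sum.inr t, Sum.inl t.1.2))}

/-! ### The generalized odd cycle condition for mixed signed, directed graphs -/

/-- The step traverses a directed edge from its tail to its head. -/
def EdgeStep.IsForward {V : Type*} (s : EdgeStep V (MixedEdge V)) : Prop :=
  s.edge = MixedEdge.directed s.src s.tgt

/-- The step traverses a directed edge from its head to its tail. -/
def EdgeStep.IsBackward {V : Type*} (s : EdgeStep V (MixedEdge V)) : Prop :=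
  s.edge = MixedEdge.directed s.tgt s.src

open Classical in
/-- The number of signed edges in a sequence of edges, counted with multiplicity. -/
def signedCount {V : Type*} (P : List (EdgeStep V (MixedEdge V))) : ℕ :=
  P.countP fun s => s.edge.IsSigned

/-- The sequence of edges `P` is a generalized alternating path. Here `[s, d] <:+: P` says that
`s` and `d` are consecutive in `P`, and `d :: (M ++ [d']) <:+: P` that `M` is the part of `P`
between the steps `d` and `d'`. -/
structure IsGenAlternating {V : Type*} (P : List (EdgeStep V (MixedEdge V))) : Prop where
  /-- The signed edges alternate after the directed edges are deleted. -/
  signs : (P.filterMap fun s => s.edge.sign?).IsChain (· ≠ ·)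
  /-- A signed edge right before a directed edge pointing along `P` is positive. -/
  before_forward : ∀ s d σ, [s, d] <:+: P → d.IsForward → s.edge.sign? = some σ → σ = 1
  /-- A signed edge right after a directed edge pointing along `P` is negative. -/
  after_forward : ∀ d s σ, [d, s] <:+: P → d.IsForward → s.edge.sign? = some σ → σ = -1
  /-- A signed edge right before a directed edge pointing against `P` is negative. -/
  before_backward : ∀ s d σ, [s, d] <:+: P → d.IsBackward → s.edge.sign? = some σ → σ = -1
  /-- A signed edge right after a directed edge pointing against `P` is positive. -/
  after_backward : ∀ d s σ, [d, s] <:+: P → d.IsBackward → s.edge.sign? = some σ → σ = 1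
  /-- Between directed edges pointing in opposite directions: an odd number of signed edges. -/
  opposite : ∀ d M d', d :: (M ++ [d']) <:+: P →
    (d.IsForward ∧ d'.IsBackward ∨ d.IsBackward ∧ d'.IsForward) → Odd (signedCount M)
  /-- Between directed edges pointing in the same direction: an even number of signed edges. -/
  same : ∀ d M d', d :: (M ++ [d']) <:+: P →
    (d.IsForward ∧ d'.IsForward ∨ d.IsBackward ∧ d'.IsBackward) → Even (signedCount M)

/-- The generalized odd cycle condition: any two cycles, each with an odd number of signed edges,
are in distinct components, have a vertex in common, or are joined by a generalized alternating
path. -/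
def MixedGraph.GenOddCycleCondition {V : Type*} (G : MixedGraph V) : Prop :=
  ∀ (u u' : V) (C C' : List (EdgeStep V (MixedEdge V))),
    IsEdgeCycle MixedEdge.ends G.edges u C → IsEdgeCycle MixedEdge.ends G.edges u' C' →
    Odd (signedCount C) → Odd (signedCount C') →
      ¬ EdgeConnected MixedEdge.ends G.edges u u' ∨
      (cycleVertices C ∩ cycleVertices C').Nonempty ∨
      ∃ i ∈ cycleVertices C, ∃ j ∈ cycleVertices C', ∃ P : List (EdgeStep V (MixedEdge V)),
        IsEdgeWalk MixedEdge.ends G.edges i P j ∧ IsGenAlternating P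

/-! ### Edge rings -/

/-- The Laurent polynomial ring `k[x_v^{±1} : v ∈ V]`; the monomial with exponent vector `a` is
`AddMonoidAlgebra.single a 1`. -/
abbrev MvLaurent (k V : Type*) [Field k] : Type _ := AddMonoidAlgebra k (V →₀ ℤ)

/-- The exponent vector of an edge: `σ (e_i + e_j)` for the edge `ij` of sign `σ`, and
`e_j - e_i` for the directed edge `(i, j)`. -/
def MixedEdge.rho {V : Type*} : MixedEdge V → (V →₀ ℤ)
  | .signed σ e => (σ : ℤ) • Sym2.lift
      ⟨fun i j => Finsupp.single i 1 + Finsupp.single j 1, fun _ _ => add_comm _ _⟩ e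
  | .directed i j => Finsupp.single j 1 - Finsupp.single i 1

/-- The quadratic monomial `(x_i x_j)^{±1}` or `x_i^{-1} x_j` of an edge. -/
def MixedEdge.monomial (k : Type*) {V : Type*} [Field k] (e : MixedEdge V) : MvLaurent k V :=
  AddMonoidAlgebra.single e.rho 1

/-- The edge ring `k[G]`. -/
def MixedGraph.edgeRing (k : Type*) {V : Type*} [Field k] (G : MixedGraph V) :
    Subalgebra k (MvLaurent k V) :=
  Algebra.adjoin k (MixedEdge.monomial k '' G.edges)

/-- `R` is generated over `k` by some set of monomials `x_i x_j`, `x_i^{-1} x_j^{-1}`,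
`x_i^{-1} x_j`. -/
def IsQuadraticMonomialGenerated {k V : Type*} [Field k]
    (R : Subalgebra k (MvLaurent k V)) : Prop :=
  ∃ S : Set (MvLaurent k V), S ⊆ Set.range (MixedEdge.monomial k) ∧ R = Algebra.adjoin k S

/-- The mixed signed, directed graph of a subring `R`: it has an edge for each quadratic monomial
in `R` (except for the trivial monomials `x_i^{-1} x_i = 1`). -/
def graphOfSubring {k V : Type*} [Field k] (R : Subalgebra k (MvLaurent k V)) :
    MixedGraph V where
  edges := {e | e.monomial k ∈ R ∧ ∀ i, e ≠ MixedEdge.directed i i}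
  not_directed_loop := fun i h => h.2 i rfl

end

/-! The edge ring is the monoid algebra of the monoid S generated by the exponent vectors of the
edges. It is normal iff S is saturated in the group it generates
(`isIntegrallyClosed_supported_iff`): the Laurent ring is normal and the integral closure of a
graded subalgebra is graded, so only monomials need testing. The field then plays no role, and the
theorem is a circle of implications: S saturated, odd cycle condition for the augmented graph,
generalized odd cycle condition, S saturated.

Generalized condition to saturation. Let a lie in the group with m • a in S. Exponent vectors of
edges have ℓ¹-norm at most 2, which makes half-integral coefficients suffice: 2 • a is a sum of
edges with natural multiplicities (`exists_nat_combination`). Removing even multiplicities leaves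
twice a vector as a sum of distinct edges, and these form edge-disjoint cycles (`exists_cycles`).
Half of a cycle with an even number of signed edges lies in S. Half of an odd cycle lies in S only
after adding or subtracting one of its vertices (`cycle_odd`). An alternating walk between two odd
cycles has a sum concentrated at its ends, which absorbs these corrections (`cycle_pair`). Parity on
each component guarantees that odd cycles can be paired (`half_cycles_mem`).

Saturation to the augmented condition. Two connected odd cycles have half sums w, w' with w + w' in
the group and 2 • (w + w') in the monoid. If no alternating path joins them, reachability by
alternating walks defines a linear functional that is nonpositive on the monoid and vanishes at w +
w'. On the face where it vanishes a parity is zero that is odd at w + w'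
(`parity_eq_zero_of_no_alternating`). Saturation passes to the augmented graph for vectors without
artificial coordinates, since sending t_(i,j) to -i retracts its monoid onto S
(`mem_augmented_of_isSaturated`).

Augmented to generalized condition. A directed edge (i, j) is read as the two signed edges -it and
+tj. Cycles of G expand to cycles with the same parity (`isEdgeCycle_expand`), alternating walks
contract to walks of G (`contract`), and the rules for generalized alternating paths amount to
consecutive steps meeting with opposite signs. -/

noncomputable section

/-! ### Normality of monoid algebras and saturation of the exponent monoid. -/

section Saturation
open AddMonoidAlgebra

namespace LaurentMonomial

variable (V : Type*)

/-- The inclusion of the nonnegative exponent vectors. -/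
def natExp : (V →₀ ℕ) →+ (V →₀ ℤ) := Finsupp.mapRange.addMonoidHom (Nat.castAddMonoidHom ℤ)

variable {V}

@[simp] lemma natExp_apply (n : V →₀ ℕ) (v : V) : natExp V n v = (n v : ℤ) := rfl

lemma natExp_injective : Function.Injective (natExp V) := fun a b h => by
  ext v
  simpa using DFunLike.congr_fun h v

variable (V) (R : Type*) [CommRing R]

/-- The polynomial ring inside the Laurent polynomial ring. -/
def ofPoly : MvPolynomial V R →+* AddMonoidAlgebra R (V →₀ ℤ) :=
  mapDomainRingHom R (natExp V)

/-- The monomials of the polynomial ring. -/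
def monomials : Submonoid (MvPolynomial V R) := MonoidHom.mrange (of R (V →₀ ℕ))

variable {V R}

@[simp] lemma ofPoly_single (n : V →₀ ℕ) (r : R) :
    ofPoly V R (single n r) = single (natExp V n) r := by
  simp [ofPoly]

lemma ofPoly_injective : Function.Injective (ofPoly V R) :=
  mapDomain_injective natExp_injective

lemma single_mem_monomials (n : V →₀ ℕ) : (single n 1 : MvPolynomial V R) ∈ monomials V R :=
  ⟨Multiplicative.ofAdd n, rfl⟩

lemma exists_of_mem_monomials {m : MvPolynomial V R} (h : m ∈ monomials V R) :
    ∃ n : V →₀ ℕ, m = single n 1 := by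
  obtain ⟨n, rfl⟩ := h
  exact ⟨n.toAdd, rfl⟩

lemma isUnit_single (a : V →₀ ℤ) : IsUnit (single a 1 : AddMonoidAlgebra R (V →₀ ℤ)) := by
  refine IsUnit.of_mul_eq_one (single (-a) 1) ?_
  simp [single_mul_single, one_def]

lemma exists_ofPoly_eq_mul_single (f : AddMonoidAlgebra R (V →₀ ℤ)) :
    ∃ (n : V →₀ ℕ) (p : MvPolynomial V R), ofPoly V R p = f * single (natExp V n) 1 := by
  induction f using AddMonoidAlgebra.induction_linear with
  | zero => exact ⟨0, 0, by simp⟩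
  | add f g hf hg =>
    obtain ⟨n, p, hp⟩ := hf
    obtain ⟨m, q, hq⟩ := hg
    refine ⟨n + m, p * single m 1 + q * single n 1, ?_⟩
    simp only [map_add, map_mul, hp, hq, ofPoly_single, mul_assoc, single_mul_single, add_mul,
      one_mul, add_comm (natExp V m)]
  | single a r =>
    refine ⟨a.mapRange (fun z => (-z).toNat) (by simp),
      single (a.mapRange Int.toNat (by simp)) r, ?_⟩
    rw [ofPoly_single, single_mul_single, mul_one]
    congr 1
    ext v
    simp
    omega

/-- A large monomial clears all negative exponents. Unique factorization, hence normality, passes to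
the Laurent ring, and integral elements can be scaled into the polynomial ring. -/
theorem isLocalization_ofPoly :
    letI := (ofPoly V R).toAlgebra
    IsLocalization (monomials V R) (AddMonoidAlgebra R (V →₀ ℤ)) := by
  let := (ofPoly V R).toAlgebra
  exact
  { map_units := fun ⟨m, hm⟩ => by
      obtain ⟨n, rfl⟩ := exists_of_mem_monomials hm
      change IsUnit (ofPoly V R _)
      rw [ofPoly_single]
      exact isUnit_single _
    surj := fun f => by
      obtain ⟨n, p, hp⟩ := exists_ofPoly_eq_mul_single f
      refine ⟨(p, ⟨_, single_mem_monomials n⟩), ?_⟩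
      change f * ofPoly V R _ = ofPoly V R _
      rw [ofPoly_single, hp]
    exists_of_eq := fun {f g} h => ⟨1, by rw [ofPoly_injective h]⟩ }

instance isIntegrallyClosed_laurent (k : Type*) [Field k] :
    IsIntegrallyClosed (AddMonoidAlgebra k (V →₀ ℤ)) := by
  let := (ofPoly V k).toAlgebra
  have := isLocalization_ofPoly (V := V) (R := k)
  have : UniqueFactorizationMonoid (AddMonoidAlgebra k (V →₀ ℤ)) :=
    UniqueFactorizationMonoid.of_isLocalization (monomials V k) _
  infer_instance

/-- The coaction `x^a ↦ x^a T^a` of the torus on the Laurent polynomial ring. -/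
def coaction : AddMonoidAlgebra R (V →₀ ℤ) →+*
    AddMonoidAlgebra (AddMonoidAlgebra R (V →₀ ℤ)) (V →₀ ℤ) :=
  (AddMonoidAlgebra.lift R (AddMonoidAlgebra (AddMonoidAlgebra R (V →₀ ℤ)) (V →₀ ℤ)) (V →₀ ℤ)
    { toFun := fun a => single a.toAdd (single a.toAdd 1)
      map_one' := rfl
      map_mul' := fun a b => by simp [single_mul_single] }).toRingHom

lemma coaction_single (a : V →₀ ℤ) (r : R) :
    coaction (single a r) = single a (single a r) := by
  simp [coaction]

/-- The point of `coaction`: homogeneous components become coefficients, so that gradedness of an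
integral closure reduces to integrality of coefficients. -/
lemma coeff_coaction (z : AddMonoidAlgebra R (V →₀ ℤ)) (a : V →₀ ℤ) :
    (coaction z).coeff a = single a (z.coeff a) := by
  induction z using AddMonoidAlgebra.induction_linear with
  | zero => simp
  | add f g hf hg => simp [hf, hg]
  | single b r =>
    rw [coaction_single]
    classical
    by_cases h : b = a
    · subst h; simp
    · simp [h]

end LaurentMonomial

namespace LaurentMonomial
variable {V R : Type*} [CommRing R]

lemma coeff_ofPoly (p : MvPolynomial V R) (n : V →₀ ℕ) :
    (ofPoly V R p).coeff (natExp V n) = MvPolynomial.coeff n p := by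
  change Finsupp.mapDomain (natExp V) (AddMonoidAlgebra.coeff p) (natExp V n) = _
  exact Finsupp.mapDomain_apply natExp_injective _ _

lemma ofPoly_map {A L : Type*} [CommRing A] [CommRing L] (f : A →+* L) (r : MvPolynomial V A) :
    ofPoly V L (MvPolynomial.map f r) = mapRingHom (V →₀ ℤ) f (ofPoly V A r) := by
  have : (ofPoly V L).comp (MvPolynomial.map f) = (mapRingHom (V →₀ ℤ) f).comp (ofPoly V A) := by
    refine MvPolynomial.ringHom_ext (fun r => ?_) fun i => ?_
    · rw [RingHom.comp_apply, RingHom.comp_apply, MvPolynomial.map_C]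
      change ofPoly V L (single 0 _) = mapRingHom (V →₀ ℤ) f (ofPoly V A (single 0 _))
      rw [ofPoly_single, ofPoly_single, mapRingHom_single]
    · rw [RingHom.comp_apply, RingHom.comp_apply, MvPolynomial.map_X]
      change ofPoly V L (single _ 1) = mapRingHom (V →₀ ℤ) f (ofPoly V A (single _ 1))
      rw [ofPoly_single, ofPoly_single, mapRingHom_single, map_one]
  exact RingHom.congr_fun this r

attribute [local instance] MvPolynomial.algebraMvPolynomial in
lemma isIntegral_coeff_of_ofPoly {A L : Type*} [CommRing A] [CommRing L] [Algebra A L]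
    {p : MvPolynomial V L}
    (h : ((mapRingHom (V →₀ ℤ) (algebraMap A L)).comp (ofPoly V A)).IsIntegralElem
      (ofPoly V L p)) (n : V →₀ ℕ) : IsIntegral A (MvPolynomial.coeff n p) := by
  have hp : IsIntegral (MvPolynomial V A) p := by
    obtain ⟨q, hq, hq'⟩ := h
    refine ⟨q, hq, ofPoly_injective ?_⟩
    rw [map_zero, Polynomial.hom_eval₂, ← hq']
    congr 1
    exact RingHom.ext fun r => ofPoly_map _ r
  exact MvPolynomial.isIntegral_iff_isIntegral_coeff.mp hp n

/-- A Laurent polynomial that is integral over the Laurent polynomials with coefficients in `A`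
has coefficients that are integral over `A`. -/
theorem isIntegral_coeff {A L : Type*} [CommRing A] [CommRing L] [Algebra A L]
    {w : AddMonoidAlgebra L (V →₀ ℤ)}
    (h : (mapRingHom (V →₀ ℤ) (algebraMap A L)).IsIntegralElem w) (a : V →₀ ℤ) :
    IsIntegral A (w.coeff a) := by
  have hclear : ∃ n : V →₀ ℕ, ((mapRingHom (V →₀ ℤ) (algebraMap A L)).comp
      (ofPoly V A)).IsIntegralElem (single (natExp V n) 1 * w) := by
    let ι := mapRingHom (V →₀ ℤ) (algebraMap A L)
    let alg1 : Algebra (AddMonoidAlgebra A (V →₀ ℤ)) (AddMonoidAlgebra L (V →₀ ℤ)) := ι.toAlgebra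
    let alg2 : Algebra (MvPolynomial V A) (AddMonoidAlgebra A (V →₀ ℤ)) := (ofPoly V A).toAlgebra
    let alg3 : Algebra (MvPolynomial V A) (AddMonoidAlgebra L (V →₀ ℤ)) :=
      (ι.comp (ofPoly V A)).toAlgebra
    have : IsScalarTower (MvPolynomial V A) (AddMonoidAlgebra A (V →₀ ℤ))
      (AddMonoidAlgebra L (V →₀ ℤ)) := IsScalarTower.of_algebraMap_eq fun _ => rfl
    have := isLocalization_ofPoly (V := V) (R := A)
    have h1 : IsIntegral (AddMonoidAlgebra A (V →₀ ℤ)) w := h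
    obtain ⟨⟨m, hm⟩, h2⟩ := h1.exists_multiple_integral_of_isLocalization (monomials V A) _
    obtain ⟨n, rfl⟩ := exists_of_mem_monomials hm
    refine ⟨n, ?_⟩
    have h3 : single (natExp V n) 1 = ι (ofPoly V A (single n 1)) := by
      rw [ofPoly_single, mapRingHom_single, map_one]
    rw [h3]
    exact h2
  obtain ⟨n, hn⟩ := hclear
  -- The first monomial made the element integral over the polynomials over `A`; a second one makes
  -- it a polynomial itself.
  obtain ⟨n', p, hp⟩ := exists_ofPoly_eq_mul_single (single (natExp V n) 1 * w)
  have h3 : ((mapRingHom (V →₀ ℤ) (algebraMap A L)).comp (ofPoly V A)).IsIntegralElem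
      (ofPoly V L p) := by
    rw [hp]
    refine RingHom.IsIntegralElem.mul _ hn ?_
    have : (single (natExp V n') 1 : AddMonoidAlgebra L (V →₀ ℤ)) =
        ((mapRingHom (V →₀ ℤ) (algebraMap A L)).comp (ofPoly V A)) (single n' 1) := by
      rw [RingHom.comp_apply, ofPoly_single, mapRingHom_single, map_one]
    rw [this]
    exact RingHom.isIntegralElem_map _
  by_cases hne : w.coeff a = 0
  · rw [hne]; exact isIntegral_zero
  have h5 : ∃ b : V →₀ ℕ, natExp V b = natExp V n + a + natExp V n' := by
    by_contra hcon
    have h6 : (ofPoly V L p).coeff (natExp V n + a + natExp V n') = 0 := by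
      change Finsupp.mapDomain (natExp V) (AddMonoidAlgebra.coeff p) _ = 0
      exact Finsupp.mapDomain_of_notMem_range _ _ fun ⟨b, hb⟩ => hcon ⟨b, hb⟩
    rw [hp] at h6
    simp [hne] at h6
  obtain ⟨b, hb⟩ := h5
  have h7 : MvPolynomial.coeff b p = w.coeff a := by
    rw [← coeff_ofPoly, hb, hp]
    simp
  rw [← h7]
  exact isIntegral_coeff_of_ofPoly h3 b

/-- The integral closure of a graded subalgebra of a Laurent polynomial ring is graded. -/
theorem isIntegral_single_coeff (A : Subalgebra R (AddMonoidAlgebra R (V →₀ ℤ)))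
    (hA : ∀ x ∈ A, ∀ a, single a (x.coeff a) ∈ A)
    {z : AddMonoidAlgebra R (V →₀ ℤ)} (hz : IsIntegral A z) (a : V →₀ ℤ) :
    IsIntegral A (single a (z.coeff a) : AddMonoidAlgebra R (V →₀ ℤ)) := by
  rw [← coeff_coaction]
  refine isIntegral_coeff (A := A) ?_ a
  have hco : ∀ x : A, coaction (x : AddMonoidAlgebra R (V →₀ ℤ)) ∈
      Set.range (mapRingHom (V →₀ ℤ) (algebraMap A (AddMonoidAlgebra R (V →₀ ℤ)))) := by
    intro x
    change _ ∈ Set.range (AddMonoidAlgebra.map _)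
    rw [range_map]
    intro b
    rw [coeff_coaction]
    exact ⟨⟨_, hA x x.2 b⟩, rfl⟩
  choose φ hφ using hco
  obtain ⟨q, hq, hq'⟩ := hz
  -- Pushed through `coaction`, the monic equation of `z` has coefficients in the Laurent
  -- polynomials over `A`, because `A` is graded.
  have hq2 : (q.map (coaction.comp (algebraMap A (AddMonoidAlgebra R (V →₀ ℤ))))) ∈
      Polynomial.lifts
        (mapRingHom (V →₀ ℤ) (algebraMap A (AddMonoidAlgebra R (V →₀ ℤ)))) := by
    rw [Polynomial.lifts_iff_coeff_lifts]
    intro i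
    rw [Polynomial.coeff_map]
    exact ⟨_, hφ _⟩
  obtain ⟨q', h1, -, h2⟩ := Polynomial.lifts_and_natDegree_eq_and_monic hq2 (hq.map _)
  refine ⟨q', h2, ?_⟩
  rw [← Polynomial.eval_map, h1, Polynomial.eval_map, ← Polynomial.hom_eval₂, hq', map_zero]

end LaurentMonomial

namespace LaurentMonomial
variable {V k : Type*} [Field k]

/-- A submonoid of an additive group is saturated if it contains every element of the group it
generates that has a positive multiple in it. -/
def IsSaturated {M : Type*} [AddCommGroup M] (S : AddSubmonoid M) : Prop :=
  ∀ a ∈ AddSubgroup.closure (S : Set M), ∀ m : ℕ, 0 < m → m • a ∈ S → a ∈ S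

/-- The Laurent polynomials all of whose exponents lie in `S`. -/
def supported (k : Type*) [Field k] (S : AddSubmonoid (V →₀ ℤ)) :
    Subalgebra k (AddMonoidAlgebra k (V →₀ ℤ)) where
  carrier := {x | ∀ a, x.coeff a ≠ 0 → a ∈ S}
  mul_mem' := by
    classical
    intro x y hx hy a ha
    have : a ∈ (x * y).coeff.support := by simpa using ha
    obtain ⟨b, hb, c, hc, rfl⟩ := Finset.mem_add.mp (support_coeff_mul_subset x y this)
    exact S.add_mem (hx b (by simpa using hb)) (hy c (by simpa using hc))
  add_mem' := by
    intro x y hx hy a ha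
    by_cases h : x.coeff a = 0
    · exact hy a fun h' => ha (by simp [h, h'])
    · exact hx a h
  algebraMap_mem' := by
    intro r a ha
    by_cases h : a = 0
    · exact h ▸ S.zero_mem
    · exact absurd (by simp [coe_algebraMap, Ne.symm h]) ha

lemma single_mem_supported {S : AddSubmonoid (V →₀ ℤ)} {a : V →₀ ℤ} (ha : a ∈ S) (r : k) :
    (single a r : AddMonoidAlgebra k (V →₀ ℤ)) ∈ supported k S := by
  intro b hb
  by_cases h : a = b
  · exact h ▸ ha
  · exact absurd (by simp [h]) hb

lemma adjoin_single_image (T : Set (V →₀ ℤ)) :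
    Algebra.adjoin k ((fun a => (single a 1 : AddMonoidAlgebra k (V →₀ ℤ))) '' T) =
      supported k (AddSubmonoid.closure T) := by
  apply le_antisymm
  · refine Algebra.adjoin_le ?_
    rintro _ ⟨a, ha, rfl⟩
    exact single_mem_supported (AddSubmonoid.subset_closure ha) 1
  · intro x hx
    have key : ∀ a ∈ AddSubmonoid.closure T, (single a 1 : AddMonoidAlgebra k (V →₀ ℤ)) ∈
        Algebra.adjoin k ((fun a => (single a 1 : AddMonoidAlgebra k (V →₀ ℤ))) '' T) := by
      intro a ha
      induction ha using AddSubmonoid.closure_induction with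
      | mem a ha => exact Algebra.subset_adjoin ⟨a, ha, rfl⟩
      | zero => exact one_mem _
      | add a b _ _ h1 h2 =>
        have := mul_mem h1 h2
        rwa [single_mul_single, one_mul] at this
    rw [← sum_coeff_single x]
    refine Subalgebra.sum_mem _ fun a ha => ?_
    have : (single a (x.coeff a) : AddMonoidAlgebra k (V →₀ ℤ)) = x.coeff a • single a 1 := by
      rw [smul_single, smul_eq_mul, mul_one]
    change single a (x.coeff a) ∈ _
    rw [this]
    exact Subalgebra.smul_mem _ (key a (hx a (by simpa using ha))) _

/-- In a monic equation of degree n, the leading term at exponent n • a must be cancelled by a term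
of some degree i < n, whose coefficient then has the exponent (n - i) • a. -/
lemma exists_nsmul_mem_of_isIntegral {S : AddSubmonoid (V →₀ ℤ)} {a : V →₀ ℤ} {r : k} (hr : r ≠ 0)
    (h : IsIntegral (supported k S) (single a r : AddMonoidAlgebra k (V →₀ ℤ))) :
    ∃ m : ℕ, 0 < m ∧ m • a ∈ S := by
  obtain ⟨p, hp, hp'⟩ := h
  rw [Polynomial.eval₂_eq_sum_range, Finset.sum_range_succ, hp.coeff_natDegree, map_one,
    one_mul] at hp'
  have h1 := congrArg (fun x => x.coeff (p.natDegree • a)) hp'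
  simp only [coeff_add, coeff_sum, single_pow, coeff_zero, Finsupp.add_apply,
    Finsupp.coe_zero, Pi.zero_apply, coeff_single, Finsupp.single_eq_same,
    Finsupp.finsetSum_apply] at h1
  have h2 : (∑ i ∈ Finset.range p.natDegree, ((algebraMap (supported k S)
      (AddMonoidAlgebra k (V →₀ ℤ)) (p.coeff i)) * single (i • a) (r ^ i)).coeff
      (p.natDegree • a)) ≠ 0 := by
    intro h3
    rw [h3, zero_add] at h1
    exact pow_ne_zero _ hr h1
  obtain ⟨i, hi, hi'⟩ := Finset.exists_ne_zero_of_sum_ne_zero h2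
  rw [Finset.mem_range] at hi
  refine ⟨p.natDegree - i, by omega, ?_⟩
  rw [coeff_mul_single_apply] at hi'
  have h4 := (p.coeff i).2 _ (left_ne_zero_of_mul hi')
  convert h4 using 1
  rw [sub_nsmul _ hi.le]

/-- Split z into its parts on and off N. Multiplication by q keeps them apart, so q kills the part
off N, which is zero because the Laurent ring is a domain. -/
lemma supported_restrict (N : AddSubgroup (V →₀ ℤ)) {p q z : AddMonoidAlgebra k (V →₀ ℤ)}
    (hq : ∀ a, q.coeff a ≠ 0 → a ∈ N) (hp : ∀ a, p.coeff a ≠ 0 → a ∈ N) (hq0 : q ≠ 0)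
    (h : q * z = p) : ∀ a, z.coeff a ≠ 0 → a ∈ N := by
  classical
  set z0 : AddMonoidAlgebra k (V →₀ ℤ) := .ofCoeff (z.coeff.filter (· ∈ N)) with hz0
  set z1 : AddMonoidAlgebra k (V →₀ ℤ) := .ofCoeff (z.coeff.filter (· ∉ N)) with hz1
  have hz : z = z0 + z1 := by
    rw [← coeff_inj, coeff_add]
    exact (Finsupp.filter_add_filter_not _ _).symm
  have h0 : ∀ a, (q * z0).coeff a ≠ 0 → a ∈ N := by
    intro a ha
    obtain ⟨b, hb, c, hc, rfl⟩ := Finset.mem_add.mp (support_coeff_mul_subset q z0 (by simpa using ha))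
    refine N.add_mem (hq b (by simpa using hb)) ?_
    have : c ∈ (z.coeff.filter (· ∈ N)).support := hc
    rw [Finsupp.support_filter, Finset.mem_filter] at this
    exact this.2
  have h1 : ∀ a, (q * z1).coeff a ≠ 0 → a ∉ N := by
    intro a ha haN
    obtain ⟨b, hb, c, hc, rfl⟩ := Finset.mem_add.mp (support_coeff_mul_subset q z1 (by simpa using ha))
    have : c ∈ (z.coeff.filter (· ∉ N)).support := hc
    rw [Finsupp.support_filter, Finset.mem_filter] at this
    exact this.2 ((N.add_mem_cancel_left (hq b (by simpa using hb))).mp haN)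
  have h2 : q * z1 = 0 := by
    ext a
    by_contra hne
    have ha := h1 a hne
    have h3 : p.coeff a = (q * z0).coeff a + (q * z1).coeff a := by
      rw [← h, hz, mul_add]; rfl
    have h4 : (q * z0).coeff a = 0 := by
      by_contra h'; exact ha (h0 a h')
    rw [h4, zero_add] at h3
    exact ha (hp a (h3 ▸ hne))
  have h3 : z1 = 0 := (mul_eq_zero.mp h2).resolve_left hq0
  intro a ha
  by_contra haN
  have : z1.coeff a = z.coeff a := Finsupp.filter_apply_pos (· ∉ N) _ haN
  rw [h3] at this
  exact ha this.symm

lemma exists_sub_of_mem_closure {M : Type*} [AddCommGroup M] {S : AddSubmonoid M} {a : M}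
    (ha : a ∈ AddSubgroup.closure (S : Set M)) : ∃ b ∈ S, ∃ c ∈ S, a = b - c := by
  induction ha using AddSubgroup.closure_induction with
  | mem x hx => exact ⟨x, hx, 0, S.zero_mem, by simp⟩
  | zero => exact ⟨0, S.zero_mem, 0, S.zero_mem, by simp⟩
  | add x y _ _ h1 h2 =>
    obtain ⟨b, hb, c, hc, rfl⟩ := h1
    obtain ⟨b', hb', c', hc', rfl⟩ := h2
    exact ⟨b + b', S.add_mem hb hb', c + c', S.add_mem hc hc', by abel⟩
  | neg x _ h =>
    obtain ⟨b, hb, c, hc, rfl⟩ := h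
    exact ⟨c, hc, b, hb, by abel⟩

/-- The quotient x^b / x^c has its m-th power in the ring, so it lies in the ring itself, and its
exponent b - c lies in S. -/
lemma isSaturated_of_isIntegrallyClosed {S : AddSubmonoid (V →₀ ℤ)}
    (hic : IsIntegrallyClosed (supported k S)) : IsSaturated S := by
  intro a ha m hm hma
  obtain ⟨b, hb, c, hc, rfl⟩ := exists_sub_of_mem_closure ha
  let K := FractionRing (supported k S)
  let mon : ∀ a ∈ S, supported k S := fun a ha => ⟨single a 1, single_mem_supported ha 1⟩
  have hmon : ∀ a (ha : a ∈ S), algebraMap (supported k S) K (mon a ha) ≠ 0 := by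
    intro a ha h
    rw [map_eq_zero_iff _ (IsFractionRing.injective (supported k S) K)] at h
    exact one_ne_zero (single_eq_zero.mp (congrArg Subtype.val h))
  have hpow : (algebraMap (supported k S) K (mon b hb) / algebraMap (supported k S) K (mon c hc)) ^ m
      = algebraMap (supported k S) K (mon _ hma) := by
    rw [div_pow, div_eq_iff (pow_ne_zero _ (hmon c hc)), ← map_pow, ← map_pow, ← map_mul]
    congr 1
    apply Subtype.ext
    change single b 1 ^ m = single (m • (b - c)) 1 * single c 1 ^ m
    rw [single_pow, single_pow, single_mul_single, one_pow, mul_one, nsmul_sub, sub_add_cancel]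
  obtain ⟨y, hy⟩ := IsIntegrallyClosed.exists_algebraMap_eq_of_isIntegral_pow (R := supported k S)
    hm (hpow ▸ isIntegral_algebraMap)
  rw [eq_div_iff (hmon c hc), ← map_mul] at hy
  have hy' : (y : AddMonoidAlgebra k (V →₀ ℤ)) * single c 1 = single b 1 :=
    congrArg Subtype.val (IsFractionRing.injective (supported k S) K hy)
  refine y.2 _ ?_
  have h := congrArg (fun x => x.coeff b) hy'
  simp only [coeff_mul_single_apply, coeff_single, Finsupp.single_eq_same, mul_one] at h
  rw [sub_eq_add_neg, h]
  exact one_ne_zero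

/-- An integral fraction is a Laurent polynomial, as the Laurent ring is normal. Its exponents lie
in the group of S by `supported_restrict`, and each has a positive multiple in S because each
homogeneous component is integral. -/
lemma isIntegrallyClosed_of_isSaturated {S : AddSubmonoid (V →₀ ℤ)} (hsat : IsSaturated S) :
    IsIntegrallyClosed (supported k S) := by
  let L := AddMonoidAlgebra k (V →₀ ℤ)
  let A := supported k S
  let K := FractionRing A
  let F := FractionRing L
  have hLF : Function.Injective (algebraMap L F) := IsFractionRing.injective L F
  have hAF : Function.Injective (algebraMap A F) := by
    rw [IsScalarTower.algebraMap_eq A L F]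
    exact hLF.comp Subtype.val_injective
  have hAF' : Function.Injective (Algebra.ofId A F) := hAF
  let f : K →ₐ[A] F := IsFractionRing.liftAlgHom hAF'
  rw [isIntegrallyClosed_iff K]
  intro y hy
  obtain ⟨p, q, hq, rfl⟩ := IsFractionRing.div_surjective (A := A) y
  have hq0 : algebraMap A F q ≠ 0 := by
    rw [Ne, map_eq_zero_iff _ hAF]
    exact nonZeroDivisors.ne_zero hq
  have hfy : IsIntegral A (f (algebraMap A K p / algebraMap A K q)) := hy.map f
  obtain ⟨z, hz⟩ := IsIntegrallyClosed.isIntegral_iff.mp (hfy.tower_top (A := L))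
  rw [map_div₀, f.commutes, f.commutes] at hz
  have hzA : IsIntegral A z := by
    rw [← isIntegral_algebraMap_iff (A := L) (B := F) hLF, hz]
    rwa [map_div₀, f.commutes, f.commutes] at hfy
  have hmul : (q : L) * z = p := by
    rw [eq_div_iff hq0, IsScalarTower.algebraMap_apply A L F, IsScalarTower.algebraMap_apply A L F,
      ← map_mul] at hz
    rw [mul_comm]
    exact hLF hz
  have hsub : ∀ x : A, ∀ a, (x : L).coeff a ≠ 0 → a ∈ AddSubgroup.closure (S : Set (V →₀ ℤ)) :=
    fun x a ha => AddSubgroup.subset_closure (x.2 a ha)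
  have hzmem : z ∈ supported k S := by
    intro a ha
    have h1 := supported_restrict _ (hsub q) (hsub p)
      (fun h => nonZeroDivisors.ne_zero hq (Subtype.ext h)) hmul a ha
    obtain ⟨m, hm, hma⟩ := exists_nsmul_mem_of_isIntegral ha
      (isIntegral_single_coeff A (fun x hx b => by
        by_cases hb : x.coeff b = 0
        · rw [hb, single_zero]; exact zero_mem _
        · exact single_mem_supported (hx b hb) _) hzA a)
    exact hsat a h1 m hm hma
  have hf : Function.Injective f := RingHom.injective (f : K →+* F)
  refine ⟨⟨z, hzmem⟩, hf ?_⟩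
  rw [f.commutes, map_div₀, f.commutes, f.commutes, ← hz]
  rfl

/-- A monoid algebra of exponents is normal iff the monoid of exponents is saturated. -/
theorem isIntegrallyClosed_supported_iff (S : AddSubmonoid (V →₀ ℤ)) :
    IsIntegrallyClosed (supported k S) ↔ IsSaturated S :=
  ⟨isSaturated_of_isIntegrallyClosed, isIntegrallyClosed_of_isSaturated⟩

end LaurentMonomial

/-- The exponent vectors of the monomials in the edge ring of `G`. -/
def MixedGraph.expMonoid {V : Type*} (G : MixedGraph V) : AddSubmonoid (V →₀ ℤ) :=
  AddSubmonoid.closure (MixedEdge.rho '' G.edges)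

theorem MixedGraph.isIntegrallyClosed_edgeRing_iff (k : Type*) {V : Type*} [Field k]
    (G : MixedGraph V) :
    IsIntegrallyClosed (G.edgeRing k) ↔ LaurentMonomial.IsSaturated G.expMonoid := by
  have : G.edgeRing k = LaurentMonomial.supported k G.expMonoid := by
    rw [MixedGraph.expMonoid, ← LaurentMonomial.adjoin_single_image, Set.image_image]
    rfl
  rw [this, LaurentMonomial.isIntegrallyClosed_supported_iff]

end Saturation

/-! ### Half-integrality of rational combinations of vectors of norm at most two. -/

namespace HalfIntegral

/-- The integers inside the rational numbers. -/
def intRat : AddSubgroup ℚ := (Int.castAddHom ℚ).range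

lemma mem_intRat {x : ℚ} : x ∈ intRat ↔ ∃ n : ℤ, (n : ℚ) = x := Iff.rfl

lemma int_mem (n : ℤ) : (n : ℚ) ∈ intRat := ⟨n, rfl⟩

lemma int_mul_mem (n : ℤ) {x : ℚ} (hx : x ∈ intRat) : (n : ℚ) * x ∈ intRat := by
  rw [← zsmul_eq_mul]; exact zsmul_mem hx n

lemma fract_eq_zero_iff_mem {x : ℚ} : Int.fract x = 0 ↔ x ∈ intRat := by
  rw [Int.fract_eq_zero_iff]; rfl

open Classical in
/-- The sign of `x` modulo `1`: it is `0` on half integers, and otherwise it tells in which half of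
the unit interval the fractional part of `x` lies. -/
def circleSign (x : ℚ) : ℤ :=
  if 2 * x ∈ intRat then 0 else if Int.fract x < 1 / 2 then 1 else -1

lemma circleSign_eq_zero {x : ℚ} (h : 2 * x ∈ intRat) : circleSign x = 0 := if_pos h

lemma circleSign_ne_zero {x : ℚ} (h : 2 * x ∉ intRat) : circleSign x ≠ 0 := by
  rw [circleSign, if_neg h]
  split_ifs <;> decide

lemma circleSign_of_sub_mem {x y : ℚ} (h : x - y ∈ intRat) : circleSign x = circleSign y := by
  obtain ⟨n, hn⟩ := mem_intRat.mp h
  have hx : x = y + n := by rw [hn]; ring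
  have h2 : 2 * x ∈ intRat ↔ 2 * y ∈ intRat := by
    have : 2 * x = 2 * y + ((2 * n : ℤ) : ℚ) := by rw [hx]; push_cast; ring
    rw [this, add_mem_cancel_right (int_mem _)]
  rw [circleSign, circleSign, h2, hx, Int.fract_add_intCast]

/-- Negation reflects the circle ℚ/ℤ; it swaps the two open halves and preserves the half integers,
where the sign is 0. -/
lemma circleSign_of_add_mem {x y : ℚ} (h : x + y ∈ intRat) : circleSign x = -circleSign y := by
  rw [circleSign_of_sub_mem (y := -y) (by simpa using h)]
  by_cases h2 : 2 * y ∈ intRat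
  · rw [circleSign_eq_zero h2, circleSign_eq_zero (by simpa using h2)]; rfl
  · have h2' : 2 * -y ∉ intRat := by simpa using h2
    have h3 : Int.fract y ≠ 0 := fun h => h2 (by
      simpa using int_mul_mem 2 (fract_eq_zero_iff_mem.mp h))
    have h4 : Int.fract y ≠ 1 / 2 := fun h => h2 (by
      have : 2 * y = ((1 + 2 * ⌊y⌋ : ℤ) : ℚ) := by
        have := Int.fract_add_floor y
        rw [h] at this
        push_cast
        linarith
      rw [this]; exact int_mem _)
    rw [circleSign, circleSign, if_neg h2, if_neg h2', Int.fract_neg h3]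
    rcases lt_or_gt_of_ne h4 with h5 | h5
    · rw [if_neg (by linarith), if_pos h5]
    · rw [if_pos (by linarith), if_neg (by linarith)]; rfl

section Vertex
variable {E : Type*} [DecidableEq E] {F : Finset E} {c : E → ℤ} {l : E → ℚ}

/-- At a vertex with an edge of nonintegral weight there are at least two half-edges; if there are
exactly two, their circle signs cancel. -/
lemma vertex_aux (hl : ∀ e ∈ F, l e ∉ intRat) (hsum : ∑ e ∈ F, l e * c e ∈ intRat)
    (hne : ∃ e ∈ F, c e ≠ 0) :
    2 ≤ ∑ e ∈ F, |c e| ∧ (∑ e ∈ F, |c e| = 2 → ∑ e ∈ F, circleSign (l e) * c e = 0) := by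
  obtain ⟨e, he, hce⟩ := hne
  rw [← Finset.add_sum_erase F _ he] at hsum ⊢
  rw [← Finset.add_sum_erase F _ he]
  have habs : 1 ≤ |c e| := Int.one_le_abs hce
  have hrest : 0 ≤ ∑ x ∈ F.erase e, |c x| := Finset.sum_nonneg fun _ _ => abs_nonneg _
  -- If only `e` meets the vertex, a coefficient ±1 would make its weight integral, so it counts at
  -- least twice; when it counts exactly twice, its weight is half-integral and has sign 0.
  -- Otherwise a second edge supplies the second half-edge.
  by_cases hall : ∀ x ∈ F.erase e, c x = 0
  · have h1 : ∑ x ∈ F.erase e, |c x| = 0 :=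
      Finset.sum_eq_zero fun x hx => by rw [hall x hx, abs_zero]
    have h2 : ∑ x ∈ F.erase e, l x * c x = 0 :=
      Finset.sum_eq_zero fun x hx => by rw [hall x hx]; simp
    have h3 : ∑ x ∈ F.erase e, circleSign (l x) * c x = 0 :=
      Finset.sum_eq_zero fun x hx => by rw [hall x hx]; simp
    rw [h2, add_zero] at hsum
    rw [h1, h3, add_zero, add_zero]
    have h4 : 2 ≤ |c e| := by
      by_contra hlt
      have h5 : |c e| = 1 := by omega
      refine hl e he ?_
      rcases abs_eq (by norm_num : (0 : ℤ) ≤ 1) |>.mp h5 with h | h <;> rw [h] at hsum <;>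
        simpa using hsum
    refine ⟨h4, fun h5 => ?_⟩
    rw [circleSign_eq_zero, zero_mul]
    rcases abs_eq (by norm_num : (0 : ℤ) ≤ 2) |>.mp h5 with h | h <;> rw [h] at hsum <;>
        simpa [mul_comm] using hsum
  · push Not at hall
    obtain ⟨e', he', hce'⟩ := hall
    rw [← Finset.add_sum_erase _ _ he'] at hsum ⊢ hrest
    rw [← Finset.add_sum_erase _ _ he']
    have habs' : 1 ≤ |c e'| := Int.one_le_abs hce'
    have hrest' : 0 ≤ ∑ x ∈ (F.erase e).erase e', |c x| :=
      Finset.sum_nonneg fun _ _ => abs_nonneg _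
    refine ⟨by omega, fun h2 => ?_⟩
    have h1 : ∑ x ∈ (F.erase e).erase e', |c x| = 0 := by omega
    have hz : ∀ x ∈ (F.erase e).erase e', c x = 0 := fun x hx =>
      abs_eq_zero.mp ((Finset.sum_eq_zero_iff_of_nonneg fun _ _ => abs_nonneg _).mp h1 x hx)
    rw [Finset.sum_eq_zero fun x hx => by rw [hz x hx]; simp, add_zero] at hsum
    rw [Finset.sum_eq_zero (s := (F.erase e).erase e') fun x hx => by rw [hz x hx]; simp, add_zero]
    have h3 : |c e| = 1 := by omega
    have h4 : |c e'| = 1 := by omega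
    rcases abs_eq (by norm_num : (0 : ℤ) ≤ 1) |>.mp h3 with h | h <;>
    rcases abs_eq (by norm_num : (0 : ℤ) ≤ 1) |>.mp h4 with h' | h' <;>
    rw [h, h'] at hsum ⊢
    · rw [circleSign_of_add_mem (x := l e) (y := l e') (by simpa using hsum)]; ring
    · rw [circleSign_of_sub_mem (x := l e) (y := l e') (by simpa [sub_eq_add_neg] using hsum)]; ring
    · rw [circleSign_of_sub_mem (x := l e) (y := l e') (by
        have := neg_mem hsum
        simpa [sub_eq_add_neg, add_comm] using this)]; ring
    · rw [circleSign_of_add_mem (x := l e) (y := l e') (by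
        have := neg_mem hsum
        simpa [add_comm] using this)]; ring

end Vertex

variable {E V : Type*} [Fintype E] [Fintype V]

open Classical in
/-- The indices of the coefficients that are not integers. -/
def nonInt (l : E → ℚ) : Finset E := Finset.univ.filter fun e => l e ∉ intRat

lemma mem_nonInt {l : E → ℚ} {e : E} : e ∈ nonInt l ↔ l e ∉ intRat := by simp [nonInt]

/-- Move along d until the first coefficient reaches an integer. A decreasing coefficient stays
above its floor, which is nonnegative, and integral coefficients do not move. -/
lemma exists_perturbation {l d : E → ℚ} (hl : ∀ e, 0 ≤ l e) (hd : ∀ e, d e ≠ 0 → e ∈ nonInt l)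
    (hne : ∃ e, d e ≠ 0) : ∃ t : ℚ, (∀ e, 0 ≤ l e + t * d e) ∧
      nonInt (fun e => l e + t * d e) ⊂ nonInt l := by
  classical
  let target : E → ℤ := fun e => if 0 < d e then ⌈l e⌉ else ⌊l e⌋
  let time : E → ℚ := fun e => (target e - l e) / d e
  have hpos : ∀ e, d e ≠ 0 → 0 < time e := by
    intro e he
    have hni := mem_nonInt.mp (hd e he)
    rcases lt_or_gt_of_ne he with h | h
    · have h1 : (⌊l e⌋ : ℚ) < l e := lt_of_le_of_ne (Int.floor_le _) fun h => hni ⟨_, h⟩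
      simp only [time, target, if_neg h.not_gt]
      exact div_pos_of_neg_of_neg (by linarith) h
    · have h1 : l e < (⌈l e⌉ : ℚ) := lt_of_le_of_ne (Int.le_ceil _) fun h => hni ⟨_, h.symm⟩
      simp only [time, target, if_pos h]
      exact div_pos (by linarith) h
  obtain ⟨e₀, he₀⟩ := hne
  obtain ⟨e₁, he₁, hmin⟩ := Finset.exists_min_image (Finset.univ.filter fun e => d e ≠ 0) time
    ⟨e₀, by simpa using he₀⟩
  replace he₁ : d e₁ ≠ 0 := by simpa using he₁
  refine ⟨time e₁, fun e => ?_, ?_⟩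
  · by_cases he : d e = 0
    · simpa [he] using hl e
    · have h1 := hmin e (by simpa using he)
      have h2 := hpos e₁ he₁
      have h3 : time e * d e = target e - l e := div_mul_cancel₀ _ he
      rcases lt_or_gt_of_ne he with h | h
      · have h4 : time e * d e ≤ time e₁ * d e := mul_le_mul_of_nonpos_right h1 h.le
        have h5 : (0 : ℚ) ≤ target e := by
          simp only [target, if_neg h.not_gt]
          exact_mod_cast Int.floor_nonneg.mpr (hl e)
        linarith
      · have := mul_pos h2 h
        linarith [hl e]
  · rw [Finset.ssubset_iff_of_subset]
    · refine ⟨e₁, hd e₁ he₁, ?_⟩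
      rw [mem_nonInt, not_not]
      have : l e₁ + time e₁ * d e₁ = target e₁ := by
        rw [div_mul_cancel₀ _ he₁]; ring
      rw [this]
      exact int_mem _
    · intro e he
      by_contra hni
      have hde : d e = 0 := by
        by_contra h; exact hni (hd e h)
      rw [mem_nonInt, hde, mul_zero, add_zero] at he
      exact hni (mem_nonInt.mpr he)

/-- Count edges of nonintegral weight against the vertices they meet. More edges than vertices gives
linear dependence. Otherwise edges have at most two half-edges and vertices at least two, so every
vertex has exactly two, and the circle signs form a relation, nonzero by `hhalf`. -/
lemma exists_relation (c : E → V → ℤ) (hc : ∀ e, ∑ v, |c e v| ≤ 2) {l : E → ℚ}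
    (hint : ∀ v, ∑ e, l e * c e v ∈ intRat) (hhalf : ∃ e, 2 * l e ∉ intRat) :
    ∃ d : E → ℚ, (∀ e, d e ≠ 0 → e ∈ nonInt l) ∧ (∃ e, d e ≠ 0) ∧
      ∀ v, ∑ e, d e * c e v = 0 := by
  classical
  set F := nonInt l with hF
  set W : Finset V := Finset.univ.filter fun v => ∃ e ∈ F, c e v ≠ 0 with hW
  have hWz : ∀ v ∉ W, ∀ e ∈ F, c e v = 0 := by
    intro v hv e he
    by_contra h
    exact hv (by rw [hW, Finset.mem_filter]; exact ⟨Finset.mem_univ _, e, he, h⟩)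
  have hintF : ∀ v, ∑ e ∈ F, l e * c e v ∈ intRat := by
    intro v
    have h := hint v
    rw [← Finset.sum_add_sum_compl F] at h
    refine (add_mem_cancel_right ?_).mp h
    refine sum_mem fun e he => ?_
    rw [Finset.mem_compl, hF, mem_nonInt, not_not] at he
    rw [mul_comm]
    exact int_mul_mem _ he
  rcases lt_or_ge W.card F.card with hlt | hge
  · have hdep : ¬ LinearIndependent ℚ (fun (e : F) (v : W) => (c e v : ℚ)) := by
      intro h
      have := h.fintype_card_le_finrank
      simp at this
      omega
    obtain ⟨g, hg, e₀, he₀⟩ := Fintype.not_linearIndependent_iff.mp hdep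
    refine ⟨fun e => if h : e ∈ F then g ⟨e, h⟩ else 0, fun e he => ?_, ⟨e₀, by simpa using he₀⟩,
      fun v => ?_⟩
    · by_contra h
      exact he (dif_neg h)
    · rw [← Finset.sum_subset (Finset.subset_univ F) (fun e _ he => by simp [he]),
        ← Finset.sum_coe_sort F]
      by_cases hv : v ∈ W
      · have := congrFun hg ⟨v, hv⟩
        simpa using this
      · exact Finset.sum_eq_zero fun e _ => by rw [hWz v hv e e.2]; simp
  · have hnon : ∀ e ∈ F, l e ∉ intRat := fun e he => mem_nonInt.mp he
    have hvert : ∀ v ∈ W, 2 ≤ ∑ e ∈ F, |c e v| ∧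
        (∑ e ∈ F, |c e v| = 2 → ∑ e ∈ F, circleSign (l e) * c e v = 0) := fun v hv =>
      vertex_aux hnon (hintF v) (Finset.mem_filter.mp hv).2
    have hsum : ∑ v ∈ W, ∑ e ∈ F, |c e v| ≤ ∑ v ∈ W, 2 := by
      calc ∑ v ∈ W, ∑ e ∈ F, |c e v| = ∑ e ∈ F, ∑ v ∈ W, |c e v| := Finset.sum_comm
        _ ≤ ∑ e ∈ F, ∑ v, |c e v| := Finset.sum_le_sum fun e _ =>
            Finset.sum_le_sum_of_subset_of_nonneg (Finset.subset_univ _) fun _ _ _ => abs_nonneg _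
        _ ≤ ∑ e ∈ F, 2 := Finset.sum_le_sum fun e _ => hc e
        _ ≤ ∑ v ∈ W, 2 := by
            simp only [Finset.sum_const, nsmul_eq_mul]
            have : (F.card : ℤ) ≤ W.card := by exact_mod_cast hge
            linarith
    have heq : ∀ v ∈ W, 2 = ∑ e ∈ F, |c e v| :=
      (Finset.sum_eq_sum_iff_of_le fun v hv => (hvert v hv).1).mp
        (le_antisymm (Finset.sum_le_sum fun v hv => (hvert v hv).1) hsum)
    have hzero : ∀ e, l e ∈ intRat → circleSign (l e) = 0 := fun e h =>
      circleSign_eq_zero (by simpa using int_mul_mem 2 h)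
    refine ⟨fun e => (circleSign (l e) : ℚ), fun e he => ?_, ?_, fun v => ?_⟩
    · rw [hF, mem_nonInt]
      exact fun h => he (by simp [hzero e h])
    · obtain ⟨e, he⟩ := hhalf
      exact ⟨e, Int.cast_ne_zero.mpr (circleSign_ne_zero he)⟩
    · rw [← Finset.sum_subset (Finset.subset_univ F) (fun e _ he => by
        rw [hF, mem_nonInt, not_not] at he
        simp [hzero e he])]
      by_cases hv : v ∈ W
      · have := (hvert v hv).2 (heq v hv).symm
        beta_reduce
        exact_mod_cast this
      · exact Finset.sum_eq_zero fun e he => by rw [hWz v hv e he]; simp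

/-- For integer vectors of `ℓ¹`-norm at most `2`, twice an integral nonnegative rational combination
is a combination with natural number coefficients. -/
theorem exists_nat_combination (c : E → V → ℤ) (hc : ∀ e, ∑ v, |c e v| ≤ 2) (l : E → ℚ)
    (hl : ∀ e, 0 ≤ l e) (hint : ∀ v, ∑ e, l e * c e v ∈ intRat) :
    ∃ n : E → ℕ, ∀ v, ∑ e, (n e : ℚ) * c e v = 2 * ∑ e, l e * c e v := by
  induction hcard : (nonInt l).card using Nat.strong_induction_on generalizing l with
  | _ N ih =>
  by_cases hhalf : ∃ e, 2 * l e ∉ intRat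
  · obtain ⟨d, hd, hne, hsum⟩ := exists_relation c hc hint hhalf
    obtain ⟨t, ht, hss⟩ := exists_perturbation hl hd hne
    have hsame : ∀ v, ∑ e, (l e + t * d e) * c e v = ∑ e, l e * c e v := by
      intro v
      simp only [add_mul, Finset.sum_add_distrib, mul_assoc, ← Finset.mul_sum, hsum v]
      ring
    obtain ⟨n, hn⟩ := ih _ (hcard ▸ Finset.card_lt_card hss) (fun e => l e + t * d e) ht
      (fun v => by rw [hsame]; exact hint v) rfl
    exact ⟨n, fun v => by rw [hn, hsame]⟩
  -- All weights are now half integers, so doubling them gives the multiplicities.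
  · push Not at hhalf
    choose n hn using fun e => mem_intRat.mp (hhalf e)
    refine ⟨fun e => (n e).toNat, fun v => ?_⟩
    rw [Finset.mul_sum]
    refine Finset.sum_congr rfl fun e _ => ?_
    have h0 : 0 ≤ n e := by
      have : (0 : ℚ) ≤ n e := by rw [hn]; linarith [hl e]
      exact_mod_cast this
    have h1 : (((n e).toNat : ℤ) : ℚ) = 2 * l e := by rw [Int.toNat_of_nonneg h0, hn]
    rw [← mul_assoc, ← h1]
    push_cast
    rfl

end HalfIntegral

/-! ### Walks, and the existence of cycles. -/

section Walks
variable {V E : Type*} {ends : E → Sym2 V} {S T : Set E} {u v w : V}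
  {P Q C : List (EdgeStep V E)}

lemma isEdgeWalk_append :
    IsEdgeWalk ends S u (P ++ Q) v ↔ ∃ w, IsEdgeWalk ends S u P w ∧ IsEdgeWalk ends S w Q v := by
  induction P generalizing u with
  | nil => simp [IsEdgeWalk]
  | cons s P ih => simp only [List.cons_append, IsEdgeWalk, ih]; grind

lemma IsEdgeWalk.mono (h : IsEdgeWalk ends S u P v) (hST : S ⊆ T) : IsEdgeWalk ends T u P v := by
  induction P generalizing u with
  | nil => exact h
  | cons s P ih => exact ⟨h.1, hST h.2.1, h.2.2.1, ih h.2.2.2⟩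

lemma IsEdgeWalk.step_mem (h : IsEdgeWalk ends S u P v) {s : EdgeStep V E} (hs : s ∈ P) :
    s.edge ∈ S ∧ ends s.edge = s(s.src, s.tgt) := by
  induction P generalizing u with
  | nil => simp at hs
  | cons t P ih =>
    rcases List.mem_cons.mp hs with rfl | hs
    · exact ⟨h.2.1, h.2.2.1⟩
    · exact ih h.2.2.2 hs

lemma IsEdgeWalk.tgt_mem (h : IsEdgeWalk ends S u P v) {s : EdgeStep V E} (hs : s ∈ P) :
    s.tgt ∈ P.map EdgeStep.src ∨ s.tgt = v := by
  induction P generalizing u with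
  | nil => simp at hs
  | cons t P ih =>
    rcases List.mem_cons.mp hs with rfl | hs
    · cases P with
      | nil => exact Or.inr h.2.2.2
      | cons t' P => exact Or.inl (by simp [h.2.2.2.1])
    · rcases ih h.2.2.2 hs with h' | h'
      · exact Or.inl (List.mem_cons_of_mem _ h')
      · exact Or.inr h'

lemma IsEdgeWalk.split (h : IsEdgeWalk ends S u P v)
    (hw : w ∈ P.map EdgeStep.src ++ [v]) : ∃ A B, P = A ++ B ∧ IsEdgeWalk ends S u A w ∧
      IsEdgeWalk ends S w B v ∧ w ∈ B.map EdgeStep.src ++ [v] := by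
  rcases List.mem_append.mp hw with hw | hw
  · obtain ⟨s, hs, rfl⟩ := List.mem_map.mp hw
    obtain ⟨A, B, rfl⟩ := List.append_of_mem hs
    obtain ⟨x, hA, hB⟩ := isEdgeWalk_append.mp h
    obtain rfl := hB.1
    exact ⟨A, s :: B, rfl, hA, hB, by simp⟩
  · obtain rfl := List.mem_singleton.mp hw
    exact ⟨P, [], by simp, h, rfl, by simp⟩

lemma IsEdgeCycle.mem_cycleVertices (h : IsEdgeCycle ends S u C) : u ∈ cycleVertices C := by
  obtain ⟨hne, hw, -⟩ := h
  cases C with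
  | nil => exact absurd rfl hne
  | cons s C => simp [cycleVertices, hw.1]

lemma IsEdgeCycle.tgt_mem (h : IsEdgeCycle ends S u C) {s : EdgeStep V E} (hs : s ∈ C) :
    s.tgt ∈ cycleVertices C := by
  rcases h.2.1.tgt_mem hs with h' | h'
  · exact h'
  · exact h' ▸ h.mem_cycleVertices

lemma IsEdgeCycle.mem_of_mem_ends (h : IsEdgeCycle ends S u C) {s : EdgeStep V E} (hs : s ∈ C)
    {x : V} (hx : x ∈ ends s.edge) : x ∈ cycleVertices C := by
  rw [(h.2.1.step_mem hs).2, Sym2.mem_iff] at hx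
  rcases hx with rfl | rfl
  · exact List.mem_map_of_mem hs
  · exact h.tgt_mem hs

lemma IsEdgeCycle.mono (h : IsEdgeCycle ends S u C) (hST : S ⊆ T) : IsEdgeCycle ends T u C :=
  ⟨h.1, h.2.1.mono hST, h.2.2⟩

lemma EdgeConnected.step (h : EdgeConnected ends S u v) {e : E} (he : e ∈ S)
    (hends : ends e = s(v, w)) : EdgeConnected ends S u w := by
  obtain ⟨P, hP⟩ := h
  have hlast : IsEdgeWalk ends S v [⟨v, e, w⟩] w := ⟨rfl, he, hends, rfl⟩
  exact ⟨P ++ [⟨v, e, w⟩], isEdgeWalk_append.mpr ⟨v, hP, hlast⟩⟩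

/-- A nonempty set of edges in which no edge has a free end contains a cycle. -/
theorem exists_isEdgeCycle [Finite V] (hne : S.Nonempty)
    (hdeg : ∀ e ∈ S, ∀ v w, ends e = s(v, w) → v = w ∨ ∃ e' ∈ S, e' ≠ e ∧ v ∈ ends e') :
    ∃ u C, IsEdgeCycle ends S u C := by
  by_contra hno
  have hloop : ∀ e ∈ S, ∀ v w, ends e = s(v, w) → v ≠ w := by
    rintro e he v _ hv rfl
    exact hno ⟨v, [⟨v, e, v⟩], by simp, ⟨rfl, he, hv, rfl⟩, by simp, by simp⟩
  -- Without a cycle, a path can be extended backwards for ever: `hdeg` supplies another edge at the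
  -- initial vertex, and a return to a visited vertex would close a cycle.
  have key : ∀ n : ℕ, ∃ (v u : V) (s : EdgeStep V E) (P : List (EdgeStep V E)),
      IsEdgeWalk ends S v (s :: P) u ∧ n ≤ P.length ∧
      ((s :: P).map EdgeStep.src ++ [u]).Nodup ∧ ((s :: P).map EdgeStep.edge).Nodup := by
    intro n
    induction n with
    | zero =>
      obtain ⟨e, he⟩ := hne
      obtain ⟨v, w, hvw⟩ : ∃ v w, ends e = s(v, w) := by
        induction h : ends e using Sym2.inductionOn with | hf v w => exact ⟨v, w, rfl⟩
      exact ⟨v, w, ⟨v, e, w⟩, [], ⟨rfl, he, hvw, rfl⟩, by simp, by simpa using hloop e he v w hvw,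
        by simp⟩
    | succ n ih =>
      obtain ⟨v, u, s, P, hwalk, hlen, hsrc, hedge⟩ := ih
      obtain ⟨e', he', hne', hv⟩ := (hdeg s.edge hwalk.2.1 s.src s.tgt hwalk.2.2.1).resolve_left
        (hloop _ hwalk.2.1 _ _ hwalk.2.2.1)
      obtain rfl : s.src = v := hwalk.1
      obtain ⟨w, hw⟩ := Sym2.mem_iff_exists.mp hv
      have hvw := hloop e' he' _ _ hw
      have hsrc' : s.src ∉ P.map EdgeStep.src ++ [u] := (List.nodup_cons.mp hsrc).1
      have hfresh : e' ∉ (s :: P).map EdgeStep.edge := by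
        intro hmem
        rcases List.mem_cons.mp hmem with h | h
        · exact hne' h
        · obtain ⟨x, hx, rfl⟩ := List.mem_map.mp h
          have hx' := (hwalk.2.2.2.step_mem hx).2
          rw [hx', Sym2.mem_iff] at hv
          rcases hv with h | h
          · exact hsrc' (h ▸ List.mem_append_left _ (List.mem_map_of_mem hx))
          · rcases hwalk.2.2.2.tgt_mem hx with h' | h'
            · exact hsrc' (h ▸ List.mem_append_left _ h')
            · exact hsrc' (by simp [h, h'])
      have hw' : ends e' = s(w, s.src) := hw.trans Sym2.eq_swap
      by_cases hmem : w ∈ (s :: P).map EdgeStep.src ++ [u]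
      · exfalso
        obtain ⟨A, B, hAB, hA, -, hwB⟩ := hwalk.split hmem
        rw [hAB] at hsrc hedge hfresh
        rw [List.map_append] at hedge hfresh
        rw [List.map_append, List.append_assoc] at hsrc
        refine hno ⟨w, ⟨w, e', s.src⟩ :: A, by simp, ⟨rfl, he', hw', hA⟩, ?_, ?_⟩
        · exact List.nodup_cons.mpr ⟨fun h => (List.nodup_append.mp hsrc).2.2 _ h _ hwB rfl,
            (List.nodup_append.mp hsrc).1⟩
        · exact List.nodup_cons.mpr ⟨fun h => hfresh (List.mem_append_left _ h),
            (List.nodup_append.mp hedge).1⟩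
      · exact ⟨w, u, ⟨w, e', s.src⟩, s :: P, ⟨rfl, he', hw', hwalk⟩, by simpa using hlen,
          List.nodup_cons.mpr ⟨hmem, hsrc⟩, List.nodup_cons.mpr ⟨hfresh, hedge⟩⟩
  -- Such a path visits at least `Nat.card V + 2` distinct vertices.
  obtain ⟨v, u, s, P, -, hlen, hnd, -⟩ := key (Nat.card V)
  have := Fintype.ofFinite V
  have h := hnd.length_le_card
  rw [Nat.card_eq_fintype_card] at hlen
  simp at h
  omega

end Walks

open LaurentMonomial

/-! ### Half sums of cycles, and pairs of odd cycles joined by alternating walks. -/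

namespace MixedGraph
variable {V : Type*} {G : MixedGraph V} {u v w i j : V} {P C C' : List (EdgeStep V (MixedEdge V))}

/-- The sum of the exponent vectors of the edges of a walk. -/
def walkSum (P : List (EdgeStep V (MixedEdge V))) : V →₀ ℤ := (P.map fun s => s.edge.rho).sum

@[simp] lemma walkSum_nil : walkSum ([] : List (EdgeStep V (MixedEdge V))) = 0 := rfl

@[simp] lemma walkSum_cons (s : EdgeStep V (MixedEdge V)) (P) :
    walkSum (s :: P) = s.edge.rho + walkSum P := rfl

@[simp] lemma walkSum_append (P Q : List (EdgeStep V (MixedEdge V))) :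
    walkSum (P ++ Q) = walkSum P + walkSum Q := by simp [walkSum]

@[simp] lemma signedCount_nil : signedCount ([] : List (EdgeStep V (MixedEdge V))) = 0 := rfl

lemma signedCount_append (P Q : List (EdgeStep V (MixedEdge V))) :
    signedCount (P ++ Q) = signedCount P + signedCount Q := by simp [signedCount]

lemma signedCount_cons_signed {s : EdgeStep V (MixedEdge V)} {σ e} (h : s.edge = .signed σ e) (P) :
    signedCount (s :: P) = signedCount P + 1 := by
  simp [signedCount, h, MixedEdge.IsSigned]

lemma signedCount_cons_directed {s : EdgeStep V (MixedEdge V)} {i j} (h : s.edge = .directed i j)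
    (P) : signedCount (s :: P) = signedCount P := by
  simp [signedCount, h, MixedEdge.IsSigned]

lemma rho_signed (σ : ℤˣ) (i j : V) : (MixedEdge.signed σ s(i, j)).rho =
    Finsupp.single i (σ : ℤ) + Finsupp.single j (σ : ℤ) := by
  simp [MixedEdge.rho]

lemma rho_directed (i j : V) : (MixedEdge.directed i j).rho =
    Finsupp.single j 1 - Finsupp.single i 1 := rfl

lemma rho_mem {e : MixedEdge V} (h : e ∈ G.edges) : e.rho ∈ G.expMonoid :=
  AddSubmonoid.subset_closure ⟨e, h, rfl⟩

/-- The added end terms equal either `e.rho` or its negative, so s is `e.rho` or 0. A signed edge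
has equal signs at its ends and a directed edge opposite ones, hence the two forms. -/
lemma step_half {e : MixedEdge V} (he : e ∈ G.edges) (hends : e.ends = s(u, w)) (d : ℤˣ) :
    (∀ σ x, e = .signed σ x → ∃ s ∈ G.expMonoid,
      e.rho + Finsupp.single u (d : ℤ) + Finsupp.single w (d : ℤ) = 2 • s) ∧
    (∀ i j, e = .directed i j → ∃ s ∈ G.expMonoid,
      e.rho + Finsupp.single u (d : ℤ) - Finsupp.single w (d : ℤ) = 2 • s) := by
  constructor
  · rintro σ x rfl
    obtain rfl : x = s(u, w) := hends
    rcases Int.units_eq_one_or σ with rfl | rfl <;> rcases Int.units_eq_one_or d with rfl | rfl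
    · exact ⟨_, rho_mem he, by rw [rho_signed]; abel⟩
    · exact ⟨0, zero_mem _, by rw [rho_signed]; simp⟩
    · exact ⟨0, zero_mem _, by rw [rho_signed]; simp⟩
    · exact ⟨_, rho_mem he, by rw [rho_signed]; abel⟩
  · rintro i j rfl
    rcases Sym2.eq_iff.mp hends with ⟨rfl, rfl⟩ | ⟨rfl, rfl⟩ <;>
      rcases Int.units_eq_one_or d with rfl | rfl
    · exact ⟨0, zero_mem _, by rw [rho_directed]; simp⟩
    · exact ⟨_, rho_mem he, by rw [rho_directed]; simp; abel⟩
    · exact ⟨_, rho_mem he, by rw [rho_directed]; simp; abel⟩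
    · exact ⟨0, zero_mem _, by rw [rho_directed]; simp; abel⟩

/-- Along a walk one can take the edges with multiplicities in `{0, 2}` so that the sum of the
exponent vectors changes only at the two ends. -/
lemma walk_half (h : IsEdgeWalk MixedEdge.ends G.edges u P v) (d : ℤˣ) :
    ∃ s ∈ G.expMonoid, walkSum P + Finsupp.single u (d : ℤ) -
      Finsupp.single v ((d * (-1) ^ signedCount P : ℤˣ) : ℤ) = 2 • s := by
  induction P generalizing u d with
  | nil =>
    obtain rfl : u = v := h
    exact ⟨0, zero_mem _, by simp⟩
  | cons s P ih =>
    obtain ⟨rfl, he, hends, hP⟩ := h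
    cases hs : s.edge with
    | signed σ x =>
      obtain ⟨a, ha, ha'⟩ := (step_half he hends d).1 σ x hs
      -- The correction sign flips across a signed edge and passes unchanged through a directed one.
      obtain ⟨b, hb, hb'⟩ := ih hP (-d)
      refine ⟨a + b, add_mem ha hb, ?_⟩
      rw [nsmul_add, ← ha', ← hb', signedCount_cons_signed hs, walkSum_cons, pow_succ]
      simp only [mul_neg, mul_one, neg_mul, Units.val_neg, Finsupp.single_neg]
      abel
    | directed i j =>
      obtain ⟨a, ha, ha'⟩ := (step_half he hends d).2 i j hs
      obtain ⟨b, hb, hb'⟩ := ih hP d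
      refine ⟨a + b, add_mem ha hb, ?_⟩
      rw [nsmul_add, ← ha', ← hb', signedCount_cons_directed hs, walkSum_cons]
      abel

lemma closedWalk_even (h : IsEdgeWalk MixedEdge.ends G.edges u C u)
    (hC : ¬ Odd (signedCount C)) : ∃ s ∈ G.expMonoid, walkSum C = 2 • s := by
  obtain ⟨s, hs, hs'⟩ := walk_half h 1
  rw [(Nat.not_odd_iff_even.mp hC).neg_one_pow] at hs'
  exact ⟨s, hs, by rw [← hs']; simp⟩

lemma closedWalk_odd (h : IsEdgeWalk MixedEdge.ends G.edges u C u)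
    (hC : Odd (signedCount C)) (d : ℤˣ) :
    ∃ s ∈ G.expMonoid, walkSum C + 2 • Finsupp.single u (d : ℤ) = 2 • s := by
  obtain ⟨s, hs, hs'⟩ := walk_half h d
  rw [hC.neg_one_pow] at hs'
  refine ⟨s, hs, ?_⟩
  rw [← hs', mul_neg, mul_one, Units.val_neg, Finsupp.single_neg]
  abel

/-- Half the sum over an odd cycle, plus or minus one of its vertices, lies in the monoid. -/
lemma cycle_odd (h : IsEdgeCycle MixedEdge.ends G.edges u C) (hC : Odd (signedCount C))
    (hi : i ∈ cycleVertices C) (d : ℤˣ) :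
    ∃ s ∈ G.expMonoid, walkSum C + 2 • Finsupp.single i (d : ℤ) = 2 • s := by
  obtain ⟨A, B, rfl, hA, hB, -⟩ := h.2.1.split (List.mem_append_left _ hi)
  -- Rotating the cycle to start at `i` changes neither its sum nor its number of signed edges.
  have hw : IsEdgeWalk MixedEdge.ends G.edges i (B ++ A) i := isEdgeWalk_append.mpr ⟨u, hB, hA⟩
  obtain ⟨s, hs, hs'⟩ := closedWalk_odd hw (by
    rw [signedCount_append] at hC ⊢; rwa [add_comm]) d
  exact ⟨s, hs, by rw [← hs', walkSum_append, walkSum_append, add_comm (walkSum A)]⟩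

open Classical in
/-- The sign with which a step leaves its source. -/
def srcSign (s : EdgeStep V (MixedEdge V)) : ℤˣ :=
  match s.edge with
  | .signed σ _ => σ
  | .directed i j => if s.src = i ∧ s.tgt = j then -1 else 1

open Classical in
/-- The sign with which a step enters its target. -/
def tgtSign (s : EdgeStep V (MixedEdge V)) : ℤˣ :=
  match s.edge with
  | .signed σ _ => σ
  | .directed i j => if s.src = i ∧ s.tgt = j then 1 else -1

lemma srcSign_signed {s : EdgeStep V (MixedEdge V)} {σ e} (h : s.edge = .signed σ e) :
    srcSign s = σ := by simp [srcSign, h]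

lemma tgtSign_signed {s : EdgeStep V (MixedEdge V)} {σ e} (h : s.edge = .signed σ e) :
    tgtSign s = σ := by simp [tgtSign, h]

lemma tgtSign_directed {s : EdgeStep V (MixedEdge V)} {i j} (h : s.edge = .directed i j) :
    tgtSign s = -srcSign s := by
  simp only [tgtSign, srcSign, h]; split_ifs <;> simp

lemma srcSign_forward {s : EdgeStep V (MixedEdge V)} (h : s.IsForward) : srcSign s = -1 := by
  rw [EdgeStep.IsForward] at h
  simp [srcSign, h]

lemma tgtSign_forward {s : EdgeStep V (MixedEdge V)} (h : s.IsForward) : tgtSign s = 1 := by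
  rw [tgtSign_directed h, srcSign_forward h, neg_neg]

lemma srcSign_backward {s : EdgeStep V (MixedEdge V)} (hs : s.edge ∈ G.edges)
    (h : s.IsBackward) : srcSign s = 1 := by
  rw [EdgeStep.IsBackward] at h
  simp only [srcSign, h]
  rw [if_neg]
  rintro ⟨h1, -⟩
  rw [h1] at h
  exact G.not_directed_loop _ (h ▸ hs)

lemma tgtSign_backward {s : EdgeStep V (MixedEdge V)} (hs : s.edge ∈ G.edges)
    (h : s.IsBackward) : tgtSign s = -1 := by
  rw [tgtSign_directed h, srcSign_backward hs h]

lemma forward_or_backward {s : EdgeStep V (MixedEdge V)} (hends : s.edge.ends = s(s.src, s.tgt))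
    {i j} (h : s.edge = .directed i j) : s.IsForward ∨ s.IsBackward := by
  rw [h] at hends
  rcases Sym2.eq_iff.mp hends with ⟨h1, h2⟩ | ⟨h1, h2⟩
  · left; rw [EdgeStep.IsForward, h, h1, h2]
  · right; rw [EdgeStep.IsBackward, h, h1, h2]

lemma rho_step {s : EdgeStep V (MixedEdge V)} (hs : s.edge ∈ G.edges)
    (hends : s.edge.ends = s(s.src, s.tgt)) :
    s.edge.rho = Finsupp.single s.src (srcSign s : ℤ) + Finsupp.single s.tgt (tgtSign s : ℤ) := by
  cases h : s.edge with
  | signed σ e =>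
    rw [h] at hends
    obtain rfl : e = s(s.src, s.tgt) := hends
    rw [srcSign_signed h, tgtSign_signed h, rho_signed]
  | directed i j =>
    rw [← h]
    rcases forward_or_backward hends h with hf | hb
    · rw [srcSign_forward hf, tgtSign_forward hf, hf, rho_directed]
      simp; abel
    · rw [srcSign_backward hs hb, tgtSign_backward hs hb, hb, rho_directed]
      simp; abel

/-- Consecutive steps meet with opposite signs. -/
def IsAlternating (P : List (EdgeStep V (MixedEdge V))) : Prop :=
  P.IsChain fun s t => tgtSign s = -srcSign t

/-- The contributions of consecutive steps cancel at the vertex where they meet, so only the two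
ends survive. -/
lemma IsAlternating.walkSum (h : IsEdgeWalk MixedEdge.ends G.edges u P v) (hP : IsAlternating P) :
    (P = [] ∧ u = v) ∨ ∃ s ∈ P.head?, ∃ b : ℤˣ,
      walkSum P = Finsupp.single u (srcSign s : ℤ) + Finsupp.single v (b : ℤ) := by
  induction P generalizing u with
  | nil => exact Or.inl ⟨rfl, h⟩
  | cons s P ih =>
    right
    obtain ⟨rfl, he, hends, hw⟩ := h
    have hrho := rho_step he hends
    refine ⟨s, rfl, ?_⟩
    rcases ih hw (List.IsChain.tail hP) with ⟨rfl, h2⟩ | ⟨t, ht, b, hb⟩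
    · exact ⟨tgtSign s, by rw [walkSum_cons, hrho, h2]; simp⟩
    · refine ⟨b, ?_⟩
      have h1 : tgtSign s = -srcSign t := (List.isChain_cons.mp hP).1 t ht
      rw [walkSum_cons, hrho, hb, h1]
      simp

lemma walkSum_mem (h : IsEdgeWalk MixedEdge.ends G.edges u P v) : walkSum P ∈ G.expMonoid :=
  list_sum_mem fun x hx => by
    obtain ⟨s, hs, rfl⟩ := List.mem_map.mp hx
    exact rho_mem (h.step_mem hs).1

/-- Two odd cycles joined by an alternating walk. -/
lemma cycle_pair_of_alternating (h : IsEdgeCycle MixedEdge.ends G.edges u C)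
    (hC : Odd (signedCount C)) (h' : IsEdgeCycle MixedEdge.ends G.edges v C')
    (hC' : Odd (signedCount C')) (hi : i ∈ cycleVertices C) (hj : j ∈ cycleVertices C')
    (hP : IsEdgeWalk MixedEdge.ends G.edges i P j) (halt : IsAlternating P) :
    ∃ s ∈ G.expMonoid, walkSum C + walkSum C' = 2 • s := by
  rcases halt.walkSum hP with ⟨rfl, rfl⟩ | ⟨s, -, b, hb⟩
  · obtain ⟨x, hx, hx'⟩ := cycle_odd h hC hi 1
    obtain ⟨y, hy, hy'⟩ := cycle_odd h' hC' hj (-1)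
    refine ⟨x + y, add_mem hx hy, ?_⟩
    rw [nsmul_add, ← hx', ← hy']
    simp only [Units.val_neg, Finsupp.single_neg]
    abel
  -- The corrections at `i` and `j` are chosen to cancel the two terms of `walkSum P`.
  · obtain ⟨x, hx, hx'⟩ := cycle_odd h hC hi (-srcSign s)
    obtain ⟨y, hy, hy'⟩ := cycle_odd h' hC' hj (-b)
    refine ⟨x + y + walkSum P, add_mem (add_mem hx hy) (walkSum_mem hP), ?_⟩
    rw [nsmul_add, nsmul_add, ← hx', ← hy', hb]
    simp only [Units.val_neg, Finsupp.single_neg]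
    abel

lemma isAlternating_of_isGenAlternating (hw : IsEdgeWalk MixedEdge.ends G.edges u P v)
    (h : IsGenAlternating P) : IsAlternating P := by
  rw [IsAlternating, List.isChain_iff_forall_rel_of_append_cons_cons]
  rintro s t A B hAB
  have hinf : [s, t] <:+: P := ⟨A, B, by simp [hAB]⟩
  obtain ⟨hs, hs'⟩ := hw.step_mem (hinf.mem (by simp : s ∈ [s, t]))
  obtain ⟨ht, ht'⟩ := hw.step_mem (hinf.mem (by simp : t ∈ [s, t]))
  cases h1 : s.edge with
  | signed σ e =>
    have h1' : s.edge.sign? = some σ := by rw [h1]; rfl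
    rw [tgtSign_signed h1]
    cases h2 : t.edge with
    | signed τ f =>
      rw [srcSign_signed h2]
      have h3 := h.signs.infix (hinf.filterMap fun s => s.edge.sign?)
      simp only [h1, h2, MixedEdge.sign?, List.filterMap_cons, List.filterMap_nil,
        List.isChain_cons_cons, List.isChain_singleton, and_true] at h3
      exact Int.units_ne_iff_eq_neg.mp h3
    | directed i j =>
      rcases forward_or_backward ht' h2 with hf | hb
      · rw [srcSign_forward hf, h.before_forward s t σ hinf hf h1']; rfl
      · rw [srcSign_backward ht hb, h.before_backward s t σ hinf hb h1']
  | directed i j =>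
    cases h2 : t.edge with
    | signed τ f =>
      have h2' : t.edge.sign? = some τ := by rw [h2]; rfl
      rw [srcSign_signed h2]
      rcases forward_or_backward hs' h1 with hf | hb
      · rw [tgtSign_forward hf, h.after_forward s t τ hinf hf h2']; rfl
      · rw [tgtSign_backward hs hb, h.after_backward s t τ hinf hb h2']
    | directed i' j' =>
      -- No signed edge lies between adjacent directed edges, and 0 is not odd, so they cannot point
      -- in opposite directions.
      have hopp := h.opposite s [] t hinf
      rcases forward_or_backward hs' h1 with hf | hb <;>
        rcases forward_or_backward ht' h2 with hf' | hb'
      · rw [tgtSign_forward hf, srcSign_forward hf']; rfl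
      · exact absurd (hopp (Or.inl ⟨hf, hb'⟩)) (by simp)
      · exact absurd (hopp (Or.inr ⟨hb, hf'⟩)) (by simp)
      · rw [tgtSign_backward hs hb, srcSign_backward ht hb']

lemma cycle_pair (hG : G.GenOddCycleCondition) (h : IsEdgeCycle MixedEdge.ends G.edges u C)
    (hC : Odd (signedCount C)) (h' : IsEdgeCycle MixedEdge.ends G.edges v C')
    (hC' : Odd (signedCount C')) (hconn : EdgeConnected MixedEdge.ends G.edges u v) :
    ∃ s ∈ G.expMonoid, walkSum C + walkSum C' = 2 • s := by
  rcases hG u v C C' h h' hC hC' with hn | ⟨i, hi, hi'⟩ | ⟨i, hi, j, hj, P, hP, halt⟩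
  · exact absurd hconn hn
  · exact cycle_pair_of_alternating (P := []) h hC h' hC' hi hi' rfl List.isChain_nil
  · exact cycle_pair_of_alternating h hC h' hC' hi hj hP (isAlternating_of_isGenAlternating hP halt)

end MixedGraph

/-! ### Parity on components, cycle decompositions and saturation. -/

namespace MixedGraph
variable {V : Type*} {G : MixedGraph V} {u v w i j : V} {P C C' : List (EdgeStep V (MixedEdge V))}

lemma two_nsmul_injective {a b : V →₀ ℤ} (h : 2 • a = 2 • b) : a = b := by
  ext v
  have := DFunLike.congr_fun h v
  simpa using this

lemma exists_half_cycle (h : IsEdgeCycle MixedEdge.ends G.edges u C) :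
    ∃ w : V →₀ ℤ, walkSum C = 2 • w ∧
      ((¬ Odd (signedCount C) ∧ w ∈ G.expMonoid) ∨
        (Odd (signedCount C) ∧ w + Finsupp.single u 1 ∈ G.expMonoid)) := by
  by_cases hC : Odd (signedCount C)
  · obtain ⟨s, hs, hs'⟩ := closedWalk_odd h.2.1 hC 1
    refine ⟨s - Finsupp.single u 1, ?_, Or.inr ⟨hC, by simpa using hs⟩⟩
    rw [nsmul_sub, ← hs']
    simp
  · obtain ⟨s, hs, hs'⟩ := closedWalk_even h.2.1 hC
    exact ⟨s, hs', Or.inl ⟨hC, hs⟩⟩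

open Classical in
/-- The sum modulo `2` of the coordinates in a set of vertices. -/
def parity (K : Set V) : (V →₀ ℤ) →+ ZMod 2 :=
  Finsupp.liftAddHom fun v => if v ∈ K then Int.castAddHom (ZMod 2) else 0

open Classical in
lemma parity_single (K : Set V) (v : V) (n : ℤ) :
    parity K (Finsupp.single v n) = if v ∈ K then (n : ZMod 2) else 0 := by
  simp only [parity, Finsupp.liftAddHom_apply_single]
  split_ifs <;> simp

lemma cast_units_zmod_two (σ : ℤˣ) : ((σ : ℤ) : ZMod 2) = 1 := by
  rcases Int.units_eq_one_or σ with rfl | rfl <;> decide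

/-- Each end contributes ±1, which is 1 modulo 2, and either both ends count or neither does. -/
lemma parity_rho {K : Set V} {e : MixedEdge V} (h : ∀ v w, e.ends = s(v, w) → (v ∈ K ↔ w ∈ K)) :
    parity K e.rho = 0 := by
  cases e with
  | signed σ x =>
    induction x using Sym2.inductionOn with
    | hf i j =>
      have := h i j rfl
      rw [rho_signed, map_add, parity_single, parity_single, this]
      split_ifs
      · rw [cast_units_zmod_two]; decide
      · simp
  | directed i j =>
    have := h i j rfl
    rw [rho_directed, map_sub, parity_single, parity_single, this, sub_self]

lemma parity_eq_zero {K : Set V}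
    (h : ∀ e ∈ G.edges, ∀ v w, e.ends = s(v, w) → (v ∈ K ↔ w ∈ K)) {b : V →₀ ℤ}
    (hb : b ∈ AddSubgroup.closure (G.expMonoid : Set (V →₀ ℤ))) : parity K b = 0 := by
  have : AddSubgroup.closure (G.expMonoid : Set (V →₀ ℤ)) ≤ (parity K).ker := by
    rw [AddSubgroup.closure_le]
    change G.expMonoid ≤ (parity K).ker.toAddSubmonoid
    rw [expMonoid, AddSubmonoid.closure_le]
    rintro _ ⟨e, he, rfl⟩
    exact parity_rho (h e he)
  exact this hb

lemma mem_component_iff (u : V) : ∀ e ∈ G.edges, ∀ v w, e.ends = s(v, w) →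
    (v ∈ {x | EdgeConnected MixedEdge.ends G.edges u x} ↔
      w ∈ {x | EdgeConnected MixedEdge.ends G.edges u x}) :=
  fun _ he _ _ hvw => ⟨fun h => EdgeConnected.step h he hvw,
    fun h => EdgeConnected.step h he (hvw.trans Sym2.eq_swap)⟩

/-- Half of an even cycle lies in the monoid and has parity 0. Half of an odd cycle differs from a
monoid element by its base vertex, so its parity on K is nonzero only if that vertex lies in K. -/
lemma exists_odd_cycle_of_parity {K : Set V}
    (h : ∀ e ∈ G.edges, ∀ v w, e.ends = s(v, w) → (v ∈ K ↔ w ∈ K))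
    (T : List (V × List (EdgeStep V (MixedEdge V))))
    (hT : ∀ c ∈ T, IsEdgeCycle MixedEdge.ends G.edges c.1 c.2) (b : V →₀ ℤ)
    (hb : 2 • b = (T.map fun c => walkSum c.2).sum) (hpar : parity K b ≠ 0) :
    ∃ c ∈ T, Odd (signedCount c.2) ∧ c.1 ∈ K := by
  induction T generalizing b with
  | nil =>
    have : b = 0 := two_nsmul_injective (by simpa using hb)
    exact absurd (by simp [this]) hpar
  | cons c T ih =>
    obtain ⟨w, hw, hw'⟩ := exists_half_cycle (hT c (by simp))
    by_cases hc : parity K w = 0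
    · obtain ⟨c', hc', h'⟩ := ih (fun c hc => hT c (List.mem_cons_of_mem _ hc)) (b - w)
        (by rw [nsmul_sub, hb, ← hw]; simp) (by rwa [map_sub, hc, sub_zero])
      exact ⟨c', List.mem_cons_of_mem _ hc', h'⟩
    · refine ⟨c, by simp, ?_⟩
      rcases hw' with ⟨-, hs⟩ | ⟨hodd, hs⟩
      · exact absurd (parity_eq_zero h (AddSubgroup.subset_closure hs)) hc
      · refine ⟨hodd, ?_⟩
        by_contra hcK
        have := parity_eq_zero h (AddSubgroup.subset_closure hs)
        rw [map_add, parity_single, if_neg hcK, add_zero] at this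
        exact hc this

/-- Under the generalized odd cycle condition, half of a sum of cycles lies in the monoid if it
lies in the group. -/
lemma half_cycles_mem (hG : G.GenOddCycleCondition)
    (T : List (V × List (EdgeStep V (MixedEdge V))))
    (hT : ∀ c ∈ T, IsEdgeCycle MixedEdge.ends G.edges c.1 c.2) (b : V →₀ ℤ)
    (hb : 2 • b = (T.map fun c => walkSum c.2).sum)
    (hmem : b ∈ AddSubgroup.closure (G.expMonoid : Set (V →₀ ℤ))) : b ∈ G.expMonoid := by
  induction hn : T.length using Nat.strong_induction_on generalizing T b with
  | _ n ih =>
  cases T with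
  | nil =>
    have : b = 0 := two_nsmul_injective (by simpa using hb)
    exact this ▸ zero_mem _
  | cons c T =>
    have hcyc := hT c (by simp)
    obtain ⟨w, hw, ⟨-, hs⟩ | ⟨hodd, hs⟩⟩ := exists_half_cycle hcyc
    · have := ih T.length (by simp [← hn]) T (fun c hc => hT c (List.mem_cons_of_mem _ hc)) (b - w)
        (by rw [nsmul_sub, hb, ← hw]; simp)
        (sub_mem hmem (AddSubgroup.subset_closure hs)) rfl
      simpa using add_mem this hs
    -- The half sum of this odd cycle has parity 1 on its component K, while `b` has parity 0 there.
    -- Hence another odd cycle lies in K, and both are split off together.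
    · set K : Set V := {x | EdgeConnected MixedEdge.ends G.edges c.1 x} with hK
      have hKc := mem_component_iff (G := G) c.1
      have hcK : c.1 ∈ K := ⟨[], rfl⟩
      have hpw : parity K w ≠ 0 := by
        intro h0
        have := parity_eq_zero hKc (AddSubgroup.subset_closure hs)
        rw [← hK, map_add, h0, parity_single, if_pos hcK] at this
        exact absurd this (by decide)
      obtain ⟨c', hc', hodd', hconn⟩ := exists_odd_cycle_of_parity hKc T
        (fun c hc => hT c (List.mem_cons_of_mem _ hc)) (b - w)
        (by rw [nsmul_sub, hb, ← hw]; simp)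
        (by rw [← hK, map_sub, parity_eq_zero hKc hmem, zero_sub]; exact neg_ne_zero.mpr hpw)
      obtain ⟨s, hs, hs'⟩ := cycle_pair hG hcyc hodd (hT c' (List.mem_cons_of_mem _ hc')) hodd' hconn
      obtain ⟨T₁, T₂, rfl⟩ := List.append_of_mem hc'
      have := ih (T₁ ++ T₂).length (by simp [← hn]) (T₁ ++ T₂)
        (fun c hc => hT c (by
          rcases List.mem_append.mp hc with h | h <;> simp [h]))
        (b - s) (by rw [nsmul_sub, hb, ← hs']; simp; abel)
        (sub_mem hmem (AddSubgroup.subset_closure hs)) rfl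
      simpa using add_mem this hs

lemma odd_rho_apply {e : MixedEdge V} (hv : e.ends = s(v, w)) (hvw : v ≠ w) : Odd (e.rho v) := by
  cases e with
  | signed σ x =>
    obtain rfl : x = s(v, w) := hv
    rw [rho_signed]
    rcases Int.units_eq_one_or σ with rfl | rfl <;> simp [hvw.symm]
  | directed i j =>
    rw [rho_directed]
    rcases Sym2.eq_iff.mp hv with ⟨rfl, rfl⟩ | ⟨rfl, rfl⟩ <;> simp [hvw]

lemma rho_apply_eq_zero {e : MixedEdge V} (hv : v ∉ e.ends) : e.rho v = 0 := by
  classical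
  cases e with
  | signed σ x =>
    induction x using Sym2.inductionOn with
    | hf i j =>
      have : v ≠ i ∧ v ≠ j := by simpa [MixedEdge.ends] using hv
      rw [rho_signed]
      simp [this.1, this.2]
  | directed i j =>
    have : v ≠ i ∧ v ≠ j := by simpa [MixedEdge.ends] using hv
    rw [rho_directed]
    simp [this.1, this.2]

lemma even_walkSum_apply (h : IsEdgeCycle MixedEdge.ends G.edges u C) (v : V) :
    Even (walkSum C v) := by
  obtain ⟨w, hw, -⟩ := exists_half_cycle h
  rw [hw]
  exact ⟨w v, by simp [two_mul]⟩

/-- A finite set of edges that meets every vertex an even number of times is a union of cycles. -/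
lemma exists_cycles [Finite V] (F : Finset (MixedEdge V)) (hF : ↑F ⊆ G.edges)
    (heven : ∀ v, Even ((∑ e ∈ F, e.rho) v)) :
    ∃ T : List (V × List (EdgeStep V (MixedEdge V))),
      (∀ c ∈ T, IsEdgeCycle MixedEdge.ends G.edges c.1 c.2) ∧
      ∑ e ∈ F, e.rho = (T.map fun c => walkSum c.2).sum := by
  classical
  induction F using Finset.strongInduction with
  | H F ih =>
  rcases F.eq_empty_or_nonempty with rfl | hne
  · exact ⟨[], by simp, by simp⟩
  obtain ⟨u, C, hC⟩ := exists_isEdgeCycle (ends := MixedEdge.ends) (S := (F : Set (MixedEdge V)))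
    hne (by
      intro e he v w hvw
      by_contra! hcon
      obtain ⟨hne, hcon⟩ := hcon
      -- If the non-loop edge `e` were the only one of F at `v`, the coordinate there would be odd.
      have h1 := heven v
      rw [← Finset.add_sum_erase F _ he, Finsupp.add_apply, Finsupp.finsetSum_apply,
        Finset.sum_eq_zero, add_zero] at h1
      · exact (Int.not_even_iff_odd.mpr (odd_rho_apply hvw hne)) h1
      · intro e' he'
        rw [Finset.mem_erase] at he'
        exact rho_apply_eq_zero (hcon e' he'.2 he'.1))
  have hCG := hC.mono hF
  set D := (C.map EdgeStep.edge).toFinset with hD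
  have hDF : D ⊆ F := by
    intro e he
    rw [hD, List.mem_toFinset, List.mem_map] at he
    obtain ⟨s, hs, rfl⟩ := he
    exact (hC.2.1.step_mem hs).1
  have hDsum : ∑ e ∈ D, e.rho = walkSum C := by
    rw [hD, List.sum_toFinset _ hC.2.2.2, List.map_map]; rfl
  have hDne : D.Nonempty := by
    rw [hD, List.toFinset_nonempty_iff]
    simpa using hC.1
  have hsum : ∑ e ∈ F, e.rho = ∑ e ∈ F \ D, e.rho + walkSum C := by
    rw [← hDsum, Finset.sum_sdiff hDF]
  obtain ⟨T, hT, hT'⟩ := ih (F \ D) (Finset.sdiff_ssubset hDF hDne)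
    (fun e he => hF (Finset.mem_sdiff.mp he).1) (fun v => by
      have h1 := heven v
      rw [hsum, Finsupp.add_apply] at h1
      exact (Int.even_add.mp h1).mpr (even_walkSum_apply hCG v))
  refine ⟨(u, C) :: T, ?_, ?_⟩
  · intro c hc
    rcases List.mem_cons.mp hc with rfl | hc
    · exact hCG
    · exact hT c hc
  · rw [hsum, hT']; simp [add_comm]

lemma sum_abs_rho_le [Fintype V] (e : MixedEdge V) : ∑ v, |e.rho v| ≤ 2 := by
  classical
  have key : ∀ (i j : V) (a b : ℤ), |a| ≤ 1 → |b| ≤ 1 →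
      ∑ v, |(Finsupp.single i a + Finsupp.single j b : V →₀ ℤ) v| ≤ 2 := by
    intro i j a b ha hb
    calc ∑ v, |(Finsupp.single i a + Finsupp.single j b : V →₀ ℤ) v|
        ≤ ∑ v, (|Finsupp.single i a v| + |Finsupp.single j b v|) :=
          Finset.sum_le_sum fun v _ => abs_add_le _ _
      _ = |a| + |b| := by
          rw [Finset.sum_add_distrib]
          congr 1
          · rw [Finset.sum_eq_single i] <;> simp +contextual [eq_comm]
          · rw [Finset.sum_eq_single j] <;> simp +contextual [eq_comm]
      _ ≤ 2 := by linarith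
  cases e with
  | signed σ x =>
    induction x using Sym2.inductionOn with
    | hf i j =>
      rw [rho_signed]
      exact key i j _ _ (by simp [Int.isUnit_iff_abs_eq.mp σ.isUnit])
        (by simp [Int.isUnit_iff_abs_eq.mp σ.isUnit])
  | directed i j =>
    rw [rho_directed, sub_eq_add_neg, ← Finsupp.single_neg]
    exact key j i _ _ (by simp) (by simp)

/-- Dividing m • a by m gives nonnegative rational coefficients for a; these are replaced by natural
multiplicities n for 2 • a. With q collecting the quotients n / 2, the vector 2 • (a - q) is the sum
of the edges of odd multiplicity, which decomposes into cycles. -/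
theorem isSaturated_of_genOddCycleCondition [Finite V] (hG : G.GenOddCycleCondition) :
    IsSaturated G.expMonoid := by
  classical
  have := Fintype.ofFinite V
  have hfin : Finite (MixedEdge V) := by
    refine Finite.of_injective (β := (ℤˣ × Sym2 V) ⊕ (V × V)) (fun e => match e with
      | .signed σ x => Sum.inl (σ, x)
      | .directed i j => Sum.inr (i, j)) ?_
    rintro (⟨σ, x⟩ | ⟨i, j⟩) (⟨τ, y⟩ | ⟨i', j'⟩) h <;> simp_all
  have := Fintype.ofFinite G.edges
  have hclos : ∀ {x : V →₀ ℤ}, x ∈ G.expMonoid →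
      ∃ n : G.edges → ℕ, x = ∑ e, n e • (e : MixedEdge V).rho := by
    intro x hx
    rw [expMonoid, Set.image_eq_range] at hx
    exact AddSubmonoid.exists_of_mem_closure_range _ _ hx
  intro a ha m hm hma
  obtain ⟨n₀, hn₀⟩ := hclos hma
  have hm' : (m : ℚ) ≠ 0 := by exact_mod_cast hm.ne'
  have hl : ∀ v, ∑ e : G.edges, ((n₀ e : ℚ) / m) * ((e : MixedEdge V).rho v : ℚ) = a v := by
    intro v
    have h1 := DFunLike.congr_fun hn₀ v
    simp only [Finsupp.finsetSum_apply, Finsupp.smul_apply, nsmul_eq_mul] at h1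
    have h2 : (m : ℚ) * a v = ∑ e : G.edges, (n₀ e : ℚ) * ((e : MixedEdge V).rho v : ℚ) := by
      exact_mod_cast h1
    rw [eq_comm, ← mul_right_inj' hm', h2, Finset.mul_sum]
    refine Finset.sum_congr rfl fun e _ => ?_
    field_simp
  obtain ⟨n, hn⟩ := HalfIntegral.exists_nat_combination
    (fun (e : G.edges) v => (e : MixedEdge V).rho v) (fun e => sum_abs_rho_le _)
    (fun e => (n₀ e : ℚ) / m) (fun e => by positivity)
    (fun v => by rw [hl]; exact HalfIntegral.int_mem _)
  have hn2 : 2 • a = ∑ e, n e • (e : MixedEdge V).rho := by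
    ext v
    have h1 := hn v
    rw [hl] at h1
    simp only [Finsupp.finsetSum_apply, Finsupp.smul_apply, nsmul_eq_mul]
    have : (2 : ℤ) * a v = ∑ e : G.edges, (n e : ℤ) * (e : MixedEdge V).rho v := by
      exact_mod_cast h1.symm
    simpa using this
  set F : Finset (MixedEdge V) := (Finset.univ.filter fun e : G.edges => Odd (n e)).map
    (Function.Embedding.subtype _) with hF
  have hFG : ↑F ⊆ G.edges := by
    intro e he
    obtain ⟨e', -, rfl⟩ := Finset.mem_map.mp (Finset.mem_coe.mp he)
    exact e'.2
  set q : V →₀ ℤ := ∑ e : G.edges, (n e / 2) • (e : MixedEdge V).rho with hq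
  have hqS : q ∈ G.expMonoid := sum_mem fun e _ => nsmul_mem (rho_mem e.2) _
  have hsplit : 2 • (a - q) = ∑ e ∈ F, e.rho := by
    rw [nsmul_sub, hn2, hq, Finset.smul_sum, sub_eq_iff_eq_add, hF, Finset.sum_map,
      Finset.sum_filter, ← Finset.sum_add_distrib]
    refine Finset.sum_congr rfl fun e _ => ?_
    rw [← mul_nsmul']
    split_ifs with h
    · have h1 : n e = 1 + 2 * (n e / 2) := by
        have := Nat.odd_iff.mp h
        omega
      conv_lhs => rw [h1, add_nsmul, one_nsmul]
      rfl
    · have h1 : n e = 2 * (n e / 2) := by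
        have := Nat.even_iff.mp (Nat.not_odd_iff_even.mp h)
        omega
      conv_lhs => rw [h1]
      rw [zero_add]
  obtain ⟨T, hT, hT'⟩ := exists_cycles F hFG (fun v => by
    rw [← hsplit]
    exact ⟨(a - q) v, by simp [two_mul]⟩)
  have := half_cycles_mem hG T hT (a - q) (hsplit.trans hT')
    (sub_mem ha (AddSubgroup.subset_closure hqS))
  simpa using add_mem this hqS

end MixedGraph

/-! ### The functional that separates cycles not joined by an alternating walk. -/

namespace SignedGraph
variable {W : Type*} {A : SignedGraph W} {u v : W} {C P : List (EdgeStep W (ℤˣ × Sym2 W))}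

/-- A signed graph as a mixed graph without directed edges. -/
def toMixed (A : SignedGraph W) : MixedGraph W where
  edges := {e | ∃ x ∈ A.edges, e = .signed x.1 x.2}
  not_directed_loop := by rintro i ⟨x, -, h⟩; cases h

/-- A step in a signed graph as a step in a mixed graph. -/
def mixedStep (s : EdgeStep W (ℤˣ × Sym2 W)) : EdgeStep W (MixedEdge W) :=
  ⟨s.src, .signed s.edge.1 s.edge.2, s.tgt⟩

lemma signed_mem_toMixed {x : ℤˣ × Sym2 W} (h : x ∈ A.edges) :
    .signed x.1 x.2 ∈ A.toMixed.edges := ⟨x, h, rfl⟩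

lemma isEdgeWalk_mixed (h : IsEdgeWalk Prod.snd A.edges u P v) :
    IsEdgeWalk MixedEdge.ends A.toMixed.edges u (P.map mixedStep) v := by
  induction P generalizing u with
  | nil => exact h
  | cons s P ih => exact ⟨h.1, signed_mem_toMixed h.2.1, h.2.2.1, ih h.2.2.2⟩

lemma map_src_mixed : (P.map mixedStep).map EdgeStep.src = P.map EdgeStep.src := by
  rw [List.map_map]; rfl

lemma cycleVertices_mixed : cycleVertices (P.map mixedStep) = cycleVertices P := by
  rw [cycleVertices, cycleVertices, map_src_mixed]

lemma isEdgeCycle_mixed (h : IsEdgeCycle Prod.snd A.edges u C) :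
    IsEdgeCycle MixedEdge.ends A.toMixed.edges u (C.map mixedStep) := by
  refine ⟨by simpa using h.1, isEdgeWalk_mixed h.2.1, by rw [map_src_mixed]; exact h.2.2.1, ?_⟩
  have : (C.map mixedStep).map EdgeStep.edge =
      (C.map EdgeStep.edge).map fun x => MixedEdge.signed x.1 x.2 := by
    simp [List.map_map, Function.comp_def, mixedStep]
  rw [this]
  exact h.2.2.2.map fun x y hxy => by
    injection hxy with h1 h2; exact Prod.ext h1 h2

lemma signedCount_mixed : signedCount (P.map mixedStep) = P.length := by
  induction P with
  | nil => rfl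
  | cons s P ih =>
    rw [List.map_cons, MixedGraph.signedCount_cons_signed (s := mixedStep s) rfl, ih,
      List.length_cons]

open MixedGraph

lemma parity_congr {K K' : Set W} {a : W →₀ ℤ} (h : ∀ v, a v ≠ 0 → (v ∈ K ↔ v ∈ K')) :
    parity K a = parity K' a := by
  classical
  simp only [parity, Finsupp.liftAddHom_apply]
  refine Finset.sum_congr rfl fun v hv => ?_
  have := h v (by simpa using hv)
  simp only [this]

lemma parity_empty (a : W →₀ ℤ) : parity (∅ : Set W) a = 0 := by
  classical
  simp [parity, Finsupp.liftAddHom_apply, Finsupp.sum]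

/-- From the set `X` one can reach `v` by an alternating walk that may continue with sign `τ`. -/
def Reach (A : SignedGraph W) (X : Set W) (v : W) (τ : ℤˣ) : Prop :=
  ∃ i ∈ X, ∃ P, IsEdgeWalk Prod.snd A.edges i P v ∧
    (P.map (fun s => s.edge.1) ++ [τ]).IsChain (· ≠ ·)

lemma Reach.of_mem {X : Set W} (h : v ∈ X) (τ : ℤˣ) : A.Reach X v τ :=
  ⟨v, h, [], rfl, by simp⟩

lemma Reach.step {X : Set W} {x : ℤˣ × Sym2 W} (hx : x ∈ A.edges) (hv : x.2 = s(u, v))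
    (h : A.Reach X u x.1) : A.Reach X v (-x.1) := by
  obtain ⟨i, hi, P, hP, hc⟩ := h
  have hlast : IsEdgeWalk Prod.snd A.edges u [⟨u, x, v⟩] v := ⟨rfl, hx, hv, rfl⟩
  refine ⟨i, hi, P ++ [⟨u, x, v⟩], isEdgeWalk_append.mpr ⟨u, hP, hlast⟩, ?_⟩
  rw [List.map_append, List.append_assoc]
  simp only [List.map_cons, List.map_nil, List.cons_append, List.nil_append]
  rw [List.isChain_append_cons_cons]
  exact ⟨hc, by rcases Int.units_eq_one_or x.1 with h | h <;> rw [h] <;> decide, List.isChain_singleton _⟩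

-- Each implication compares two indicators. If the sum is 0, both implications are equivalences,
-- and swapping the two signs identifies the pair at one end with the pair at the other.
open Classical in
lemma indicator_sum {p₁ p₂ q₁ q₂ : Prop} (h₁ : p₁ → q₂) (h₂ : q₁ → p₂) :
    ((if p₁ then 1 else 0) - (if p₂ then 1 else 0) + ((if q₁ then 1 else 0) -
      (if q₂ then 1 else 0)) : ℤ) ≤ 0 ∧
    (((if p₁ then 1 else 0) - (if p₂ then 1 else 0) + ((if q₁ then 1 else 0) -
      (if q₂ then 1 else 0)) : ℤ) = 0 → ((p₁ ∧ p₂) ↔ (q₁ ∧ q₂))) := by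
  by_cases a : p₁ <;> by_cases b : p₂ <;> by_cases c : q₁ <;> by_cases d : q₂ <;> simp_all

open Classical in
/-- The difference of the indicators of leaving `v` with sign `1` and with sign `-1`. -/
def reachDiff (A : SignedGraph W) (X : Set W) (v : W) : ℤ :=
  (if A.Reach X v 1 then 1 else 0) - (if A.Reach X v (-1) then 1 else 0)

lemma reachDiff_edge {X : Set W} {σ : ℤˣ} {p q : W} (hx : (σ, s(p, q)) ∈ A.edges) :
    σ * (A.reachDiff X p + A.reachDiff X q) ≤ 0 ∧
      (σ * (A.reachDiff X p + A.reachDiff X q) = 0 →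
        ((A.Reach X p 1 ∧ A.Reach X p (-1)) ↔ (A.Reach X q 1 ∧ A.Reach X q (-1)))) := by
  have h1 : A.Reach X p σ → A.Reach X q (-σ) := Reach.step hx rfl
  have h2 : A.Reach X q σ → A.Reach X p (-σ) := Reach.step hx Sym2.eq_swap
  rcases Int.units_eq_one_or σ with rfl | rfl
  · have h := indicator_sum h1 h2
    rw [Units.val_one, one_mul]
    exact h
  · rw [neg_neg] at h1 h2
    have h := indicator_sum h1 h2
    rw [Units.val_neg, Units.val_one]
    unfold reachDiff
    refine ⟨by linarith [h.1], fun h0 => ?_⟩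
    have := h.2 (by linarith)
    tauto

/-- The functional on exponent vectors with coefficients `reachDiff`. -/
def reachForm (A : SignedGraph W) (X : Set W) : (W →₀ ℤ) →+ ℤ :=
  Finsupp.liftAddHom fun v => AddMonoidHom.mulRight (A.reachDiff X v)

lemma reachForm_single {X : Set W} (v : W) (n : ℤ) :
    A.reachForm X (Finsupp.single v n) = n * A.reachDiff X v := by simp [reachForm]

lemma reachForm_eq_zero {X : Set W} {b : W →₀ ℤ} (hb : ∀ v, b v ≠ 0 → A.reachDiff X v = 0) :
    A.reachForm X b = 0 := by
  simp only [reachForm, Finsupp.liftAddHom_apply]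
  refine Finset.sum_eq_zero fun v hv => ?_
  simp [hb v (by simpa using hv)]

/-- The form is nonpositive on generators, so its zeros in the monoid are sums of generators on
which it vanishes. Such an edge has both ends or neither in the set of vertices that can be left
with both signs, hence parity 0. -/
lemma reachForm_le {X : Set W} {s : W →₀ ℤ} (hs : s ∈ A.toMixed.expMonoid) :
    A.reachForm X s ≤ 0 ∧ (A.reachForm X s = 0 →
      parity {v | A.Reach X v 1 ∧ A.Reach X v (-1)} s = 0) := by
  induction hs using AddSubmonoid.closure_induction with
  | mem s hs =>
    obtain ⟨_, ⟨⟨σ, e⟩, hx, rfl⟩, rfl⟩ := hs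
    induction e using Sym2.inductionOn with
    | hf p q =>
      have h := reachDiff_edge (X := X) hx
      have hval : A.reachForm X (MixedEdge.signed σ s(p, q)).rho =
          σ * (A.reachDiff X p + A.reachDiff X q) := by
        rw [rho_signed, map_add, reachForm_single, reachForm_single, mul_add]
      change A.reachForm X (MixedEdge.signed σ s(p, q)).rho ≤ 0 ∧
        (A.reachForm X (MixedEdge.signed σ s(p, q)).rho = 0 →
          parity _ (MixedEdge.signed σ s(p, q)).rho = 0)
      rw [hval]
      refine ⟨h.1, fun h0 => parity_rho fun v w hvw => ?_⟩
      rcases Sym2.eq_iff.mp hvw with ⟨rfl, rfl⟩ | ⟨rfl, rfl⟩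
      · exact h.2 h0
      · exact (h.2 h0).symm
  | zero => simp
  | add x y _ _ hx hy =>
    refine ⟨by rw [map_add]; linarith [hx.1, hy.1], fun h => ?_⟩
    rw [map_add] at h
    rw [map_add, hx.2 (by linarith [hx.1, hy.1]), hy.2 (by linarith [hx.1, hy.1]), add_zero]

/-- If no alternating walk joins `X` to `X'`, then a vector of the monoid supported on `X ∪ X'` has
even coordinate sum over `X`. -/
theorem parity_eq_zero_of_no_alternating {X X' : Set W}
    (hno : ¬ ∃ i ∈ X, ∃ j ∈ X', ∃ P, IsEdgeWalk Prod.snd A.edges i P j ∧ IsSignAlternating P)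
    {a a' : W →₀ ℤ} (ha : ∀ v, a v ≠ 0 → v ∈ X) (ha' : ∀ v, a' v ≠ 0 → v ∈ X')
    (hmem : a + a' ∈ A.toMixed.expMonoid) : parity Set.univ a = 0 := by
  -- Vertices of X' can be left with neither sign, and vertices of X with both, by the empty walk.
  -- The form therefore vanishes on vectors supported on X or X', while the parity sees all of `a`
  -- and nothing of `a'`.
  have hX' : ∀ v ∈ X', ∀ τ, ¬ A.Reach X v τ := by
    rintro v hv τ ⟨i, hi, P, hP, hc⟩
    exact hno ⟨i, hi, v, hv, P, hP, (List.isChain_append.mp hc).1⟩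
  have hfa : A.reachForm X (a + a') = 0 := by
    rw [map_add, reachForm_eq_zero, reachForm_eq_zero, add_zero]
    · intro v hv
      simp [reachDiff, hX' v (ha' v hv)]
    · intro v hv
      simp [reachDiff, Reach.of_mem (ha v hv)]
  have h1 := (reachForm_le hmem).2 hfa
  have h2 : parity {v | A.Reach X v 1 ∧ A.Reach X v (-1)} a' = 0 := by
    rw [parity_congr (K' := ∅), parity_empty]
    intro v hv
    simp [hX' v (ha' v hv)]
  have h3 : parity {v | A.Reach X v 1 ∧ A.Reach X v (-1)} a = parity Set.univ a :=
    parity_congr fun v hv => by simp [Reach.of_mem (ha v hv)]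
  rwa [map_add, h2, add_zero, h3] at h1

end SignedGraph

/-! ### The exponent monoid of the augmented graph. -/

namespace MixedGraph
variable {V : Type*} {G : MixedGraph V}

/-- The edge `-it` of the augmented graph, where `t = t_{(i, j)}`. -/
def negEdge (t : {p : V × V // MixedEdge.directed p.1 p.2 ∈ G.edges}) :
    ℤˣ × Sym2 G.AugVertex := (-1, s(Sum.inl t.1.1, Sum.inr t))

/-- The edge `+tj` of the augmented graph, where `t = t_{(i, j)}`. -/
def posEdge (t : {p : V × V // MixedEdge.directed p.1 p.2 ∈ G.edges}) :
    ℤˣ × Sym2 G.AugVertex := (1, s(Sum.inr t, Sum.inl t.1.2))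

/-- The edge `x` of the augmented graph comes from the edge `e`. -/
def EdgeOf (x : ℤˣ × Sym2 G.AugVertex) (e : MixedEdge V) : Prop :=
  (∃ σ y, e = .signed σ y ∧ x = (σ, y.map Sum.inl)) ∨
    ∃ t : {p : V × V // MixedEdge.directed p.1 p.2 ∈ G.edges},
      e = .directed t.1.1 t.1.2 ∧ (x = negEdge t ∨ x = posEdge t)

lemma mem_augmented_edges {x : ℤˣ × Sym2 G.AugVertex} :
    x ∈ G.augmented.edges ↔ ∃ e ∈ G.edges, EdgeOf x e := by
  constructor
  · rintro (⟨σ, y, h, rfl⟩ | ⟨t, h⟩)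
    · exact ⟨_, h, Or.inl ⟨σ, y, rfl, rfl⟩⟩
    · exact ⟨_, t.2, Or.inr ⟨t, rfl, h⟩⟩
  · rintro ⟨e, he, ⟨σ, y, rfl, rfl⟩ | ⟨t, rfl, h⟩⟩
    · exact Or.inl ⟨σ, y, he, rfl⟩
    · exact Or.inr ⟨t, h⟩

/-- The exponent vector of an edge of the augmented graph. -/
abbrev augRho (x : ℤˣ × Sym2 G.AugVertex) : G.AugVertex →₀ ℤ := (MixedEdge.signed x.1 x.2).rho

/-- The exponent vectors of `G` as exponent vectors of the augmented graph. -/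
def augIncl (G : MixedGraph V) : (V →₀ ℤ) →+ (G.AugVertex →₀ ℤ) :=
  Finsupp.mapDomain.addMonoidHom Sum.inl

/-- The retraction of `augIncl` that sends `t_{(i, j)}` to `-i`. -/
def augProj (G : MixedGraph V) : (G.AugVertex →₀ ℤ) →+ (V →₀ ℤ) :=
  Finsupp.liftAddHom fun x => match x with
    | Sum.inl v => Finsupp.singleAddHom v
    | Sum.inr t => -(Finsupp.singleAddHom t.1.1 : ℤ →+ (V →₀ ℤ))

lemma augIncl_single (v : V) (n : ℤ) :
    augIncl G (Finsupp.single v n) = Finsupp.single (Sum.inl v) n := by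
  simp [augIncl]

lemma augProj_inl (v : V) (n : ℤ) :
    augProj G (Finsupp.single (Sum.inl v) n) = Finsupp.single v n := by
  simp [augProj]

lemma augProj_inr (t : {p : V × V // MixedEdge.directed p.1 p.2 ∈ G.edges}) (n : ℤ) :
    augProj G (Finsupp.single (Sum.inr t) n) = -Finsupp.single t.1.1 n := by
  simp [augProj]

lemma augProj_augIncl (a : V →₀ ℤ) : augProj G (augIncl G a) = a := by
  have : (augProj G).comp (augIncl G) = AddMonoidHom.id _ := by
    refine Finsupp.addHom_ext fun v n => ?_
    rw [AddMonoidHom.comp_apply, augIncl_single, augProj_inl]; rfl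
  exact DFunLike.congr_fun this a

lemma augRho_signed (σ : ℤˣ) (y : Sym2 V) :
    augRho (G := G) (σ, y.map Sum.inl) = augIncl G (MixedEdge.signed σ y).rho := by
  induction y using Sym2.inductionOn with
  | hf i j =>
    rw [augRho, Sym2.map_mk, rho_signed, rho_signed, map_add, augIncl_single, augIncl_single]

/-- Substituting -i for t kills the vector of -it and turns that of +tj into that of (i, j). -/
lemma augProj_mem {a : G.AugVertex →₀ ℤ} (ha : a ∈ G.augmented.toMixed.expMonoid) :
    augProj G a ∈ G.expMonoid := by
  have : G.augmented.toMixed.expMonoid ≤ G.expMonoid.comap (augProj G) := by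
    rw [MixedGraph.expMonoid, AddSubmonoid.closure_le]
    rintro _ ⟨_, ⟨x, hx, rfl⟩, rfl⟩
    obtain ⟨e, he, ⟨σ, y, rfl, rfl⟩ | ⟨t, rfl, rfl | rfl⟩⟩ := mem_augmented_edges.mp hx
    · change augProj G (augRho _) ∈ G.expMonoid
      rw [augRho_signed, augProj_augIncl]
      exact rho_mem he
    · change augProj G (MixedEdge.signed _ s(_, _)).rho ∈ G.expMonoid
      rw [rho_signed, map_add, augProj_inl, augProj_inr, add_neg_cancel]
      exact zero_mem _
    · change augProj G (MixedEdge.signed _ s(_, _)).rho ∈ G.expMonoid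
      rw [rho_signed, map_add, augProj_inl, augProj_inr, neg_add_eq_sub]
      exact rho_mem he
  exact this ha

lemma augIncl_mem {a : V →₀ ℤ} (ha : a ∈ G.expMonoid) :
    augIncl G a ∈ G.augmented.toMixed.expMonoid := by
  have hmem : ∀ x ∈ G.augmented.edges, augRho x ∈ G.augmented.toMixed.expMonoid :=
    fun x hx => rho_mem (SignedGraph.signed_mem_toMixed hx)
  have : G.expMonoid ≤ G.augmented.toMixed.expMonoid.comap (augIncl G) := by
    rw [MixedGraph.expMonoid, AddSubmonoid.closure_le]
    rintro _ ⟨e, he, rfl⟩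
    change augIncl G e.rho ∈ G.augmented.toMixed.expMonoid
    cases e with
    | signed σ y =>
      rw [← augRho_signed]
      exact hmem _ (mem_augmented_edges.mpr ⟨_, he, Or.inl ⟨σ, y, rfl, rfl⟩⟩)
    | directed i j =>
      have h1 := hmem _ (mem_augmented_edges.mpr ⟨_, he, Or.inr ⟨⟨(i, j), he⟩, rfl, Or.inl rfl⟩⟩)
      have h2 := hmem _ (mem_augmented_edges.mpr ⟨_, he, Or.inr ⟨⟨(i, j), he⟩, rfl, Or.inr rfl⟩⟩)
      convert add_mem h1 h2 using 1
      rw [rho_directed, map_sub, augIncl_single, augIncl_single, augRho, augRho, negEdge, posEdge,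
        rho_signed, rho_signed]
      simp
      abel
  exact this ha

/-- A vector without artificial coordinates is the inclusion of its projection. Both hypotheses
project to G, where saturation applies, and `augIncl_mem` returns. -/
lemma mem_augmented_of_isSaturated (hsat : IsSaturated G.expMonoid) {a : G.AugVertex →₀ ℤ}
    (h0 : ∀ t, a (Sum.inr t) = 0)
    (ha : a ∈ AddSubgroup.closure (G.augmented.toMixed.expMonoid : Set (G.AugVertex →₀ ℤ)))
    (h2 : 2 • a ∈ G.augmented.toMixed.expMonoid) : a ∈ G.augmented.toMixed.expMonoid := by
  have hinj : Function.Injective (Sum.inl : V → G.AugVertex) := Sum.inl_injective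
  have hab : augIncl G (a.comapDomain Sum.inl hinj.injOn) = a := by
    refine Finsupp.mapDomain_comapDomain _ hinj a ?_
    rintro (v | t) hv
    · exact ⟨v, rfl⟩
    · exact absurd (h0 t) (by simpa using hv)
  have hproj : augProj G a = a.comapDomain Sum.inl hinj.injOn := by
    conv_lhs => rw [← hab]
    exact augProj_augIncl _
  rw [← hab, ← hproj]
  refine augIncl_mem (hsat _ ?_ 2 two_pos ?_)
  · have : AddSubgroup.closure (G.augmented.toMixed.expMonoid : Set (G.AugVertex →₀ ℤ)) ≤
        (AddSubgroup.closure (G.expMonoid : Set (V →₀ ℤ))).comap (augProj G) := by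
      rw [AddSubgroup.closure_le]
      exact fun b hb => AddSubgroup.subset_closure (augProj_mem hb)
    exact this ha
  · rw [← map_nsmul]
    exact augProj_mem h2

end MixedGraph

/-! ### From saturation to the odd cycle condition of the augmented graph. -/

namespace MixedGraph
variable {V : Type*} {G : MixedGraph V}

lemma walkSum_apply_eq_zero {u v : V} {C : List (EdgeStep V (MixedEdge V))}
    (h : IsEdgeCycle MixedEdge.ends G.edges u C) (hv : v ∉ cycleVertices C) : walkSum C v = 0 := by
  have : ∀ P : List (EdgeStep V (MixedEdge V)), (∀ s ∈ P, v ∉ s.edge.ends) → walkSum P v = 0 := by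
    intro P hP
    induction P with
    | nil => rfl
    | cons s P ih =>
      rw [walkSum_cons, Finsupp.add_apply, rho_apply_eq_zero (hP s (by simp)),
        ih fun t ht => hP t (List.mem_cons_of_mem _ ht), add_zero]
  exact this C fun s hs hmem => hv (h.mem_of_mem_ends hs hmem)

open Classical in
lemma augRho_apply_inr {x : ℤˣ × Sym2 G.AugVertex} (hx : x ∈ G.augmented.edges) (t) :
    augRho x (Sum.inr t) = if x = posEdge t then 1 else if x = negEdge t then -1 else 0 := by
  obtain ⟨e, he, ⟨σ, y, rfl, rfl⟩ | ⟨t', rfl, rfl | rfl⟩⟩ := mem_augmented_edges.mp hx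
  · induction y using Sym2.inductionOn with
    | hf i j =>
      change (MixedEdge.signed σ s(_, _)).rho _ = _
      rw [rho_signed]
      simp [posEdge, negEdge]
  · change (MixedEdge.signed _ s(_, _)).rho _ = _
    rw [rho_signed]
    by_cases h : t' = t
    · subst h; simp [posEdge, negEdge]
    · simp [posEdge, negEdge, h]
  · change (MixedEdge.signed _ s(_, _)).rho _ = _
    rw [rho_signed]
    by_cases h : t' = t
    · subst h; simp [posEdge]
    · simp [posEdge, negEdge, h]

/-- Only two edges meet an artificial vertex; they have opposite signs, and each occurs at most
once. -/
lemma sum_augRho_apply_inr {L : List (ℤˣ × Sym2 G.AugVertex)} (hL : ∀ x ∈ L, x ∈ G.augmented.edges)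
    (hnd : L.Nodup) (t) : |(L.map fun x => augRho x (Sum.inr t)).sum| ≤ 1 := by
  classical
  have hne : posEdge t ≠ negEdge t := by simp [posEdge, negEdge, Prod.ext_iff]
  have h : (L.map fun x => augRho x (Sum.inr t)).sum =
      (L.count (posEdge t) : ℤ) - L.count (negEdge t) := by
    clear hnd
    induction L with
    | nil => simp
    | cons x L ih =>
      rw [List.map_cons, List.sum_cons, ih fun y hy => hL y (List.mem_cons_of_mem _ hy),
        augRho_apply_inr (hL x (by simp))]
      simp only [List.count_cons, beq_iff_eq]
      split_ifs with h1 h2 h2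
      · exact absurd (h1.symm.trans h2) hne
      all_goals push_cast; ring
  have h1 := List.nodup_iff_count_le_one.mp hnd (posEdge t)
  have h2 := List.nodup_iff_count_le_one.mp hnd (negEdge t)
  rw [h, abs_le]
  constructor <;> omega

/-- The coordinate of the cycle sum is even and at most 1 in absolute value. This puts half sums in
the range of `mem_augmented_of_isSaturated`. -/
lemma half_cycle_apply_inr {u : G.AugVertex}
    {C : List (EdgeStep G.AugVertex (ℤˣ × Sym2 G.AugVertex))}
    (h : IsEdgeCycle Prod.snd G.augmented.edges u C) {w : G.AugVertex →₀ ℤ}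
    (hw : walkSum (C.map SignedGraph.mixedStep) = 2 • w) (t) : w (Sum.inr t) = 0 := by
  have h1 := sum_augRho_apply_inr (L := C.map EdgeStep.edge) (fun x hx => by
    obtain ⟨s, hs, rfl⟩ := List.mem_map.mp hx
    exact (h.2.1.step_mem hs).1) h.2.2.2 t
  have h2 : ((C.map EdgeStep.edge).map fun x => augRho x (Sum.inr t)).sum =
      walkSum (C.map SignedGraph.mixedStep) (Sum.inr t) := by
    clear hw h h1
    induction C with
    | nil => rfl
    | cons s C ih =>
      rw [List.map_cons, List.map_cons, List.sum_cons, ih]; rfl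
  rw [h2, hw] at h1
  simp only [Finsupp.smul_apply, nsmul_eq_mul, Nat.cast_ofNat] at h1
  rw [abs_le] at h1
  omega

theorem augmented_oddCycleCondition_of_isSaturated (hsat : IsSaturated G.expMonoid) :
    G.augmented.OddCycleCondition := by
  intro u u' C C' hC hC' hodd hodd'
  by_contra! hcon
  obtain ⟨hconn, hdisj, hno⟩ := hcon
  set H := G.augmented.toMixed with hH
  have hCm := SignedGraph.isEdgeCycle_mixed hC
  have hCm' := SignedGraph.isEdgeCycle_mixed hC'
  rw [← SignedGraph.signedCount_mixed] at hodd hodd'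
  obtain ⟨w, hw, hw1⟩ := exists_half_cycle hCm
  obtain ⟨w', hw', hw1'⟩ := exists_half_cycle hCm'
  replace hw1 := (hw1.resolve_left fun h => h.1 hodd).2
  replace hw1' := (hw1'.resolve_left fun h => h.1 hodd').2
  have hsub : ∀ {a}, a ∈ H.expMonoid →
      a ∈ AddSubgroup.closure (H.expMonoid : Set (G.AugVertex →₀ ℤ)) :=
    fun h => AddSubgroup.subset_closure h
  have hu' : 2 • Finsupp.single u' (1 : ℤ) ∈
      AddSubgroup.closure (H.expMonoid : Set (G.AugVertex →₀ ℤ)) := by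
    obtain ⟨s, hs, hs'⟩ := closedWalk_odd hCm'.2.1 hodd' 1
    have h := sub_mem (nsmul_mem (hsub hs) 2) (hsub (walkSum_mem hCm'.2.1))
    rwa [← hs', add_sub_cancel_left] at h
  -- A connecting walk puts u - u' or u + u' in the group; adding 2u', available from the odd cycle
  -- C', repairs the first case.
  have huu' : Finsupp.single u (1 : ℤ) + Finsupp.single u' 1 ∈
      AddSubgroup.closure (H.expMonoid : Set (G.AugVertex →₀ ℤ)) := by
    obtain ⟨P, hP⟩ := hconn
    have hPm := SignedGraph.isEdgeWalk_mixed hP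
    obtain ⟨s, hs, hs'⟩ := walk_half hPm 1
    have h := sub_mem (nsmul_mem (hsub hs) 2) (hsub (walkSum_mem hPm))
    rw [← hs', add_sub_assoc, add_sub_cancel_left, one_mul] at h
    rcases neg_one_pow_eq_or ℤˣ (signedCount (P.map SignedGraph.mixedStep)) with h1 | h1 <;>
      rw [h1] at h
    · have h3 := add_mem h hu'
      convert h3 using 1
      simp only [Units.val_one]
      abel
    · simpa using h
  have hmem : w + w' ∈ H.expMonoid := by
    refine mem_augmented_of_isSaturated hsat (fun t => ?_) ?_ ?_
    · rw [Finsupp.add_apply, half_cycle_apply_inr hC hw, half_cycle_apply_inr hC' hw', add_zero]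
    · have h := sub_mem (add_mem (hsub hw1) (hsub hw1')) huu'
      convert h using 1
      abel
    · rw [nsmul_add, ← hw, ← hw']
      exact add_mem (walkSum_mem hCm.2.1) (walkSum_mem hCm'.2.1)
  have hsupp : ∀ {u : G.AugVertex} {C} (_ : IsEdgeCycle Prod.snd G.augmented.edges u C)
      {w : G.AugVertex →₀ ℤ} (_ : walkSum (C.map SignedGraph.mixedStep) = 2 • w),
      ∀ v, w v ≠ 0 → v ∈ cycleVertices C := by
    intro u C hC w hw v hv
    by_contra hvC
    have := walkSum_apply_eq_zero (SignedGraph.isEdgeCycle_mixed hC)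
      (by rwa [SignedGraph.cycleVertices_mixed])
    rw [hw] at this
    exact hv (by simpa using this)
  have hpar := SignedGraph.parity_eq_zero_of_no_alternating (X := cycleVertices C)
    (X' := cycleVertices C') (by
      rintro ⟨i, hi, j, hj, P, hP, halt⟩
      exact hno i hi j hj P hP halt) (hsupp hC hw) (hsupp hC' hw') hmem
  -- Since w + u lies in the monoid, w has odd coordinate sum, against `hpar`.
  have hpar1 := parity_eq_zero (G := H) (K := Set.univ) (by simp) (hsub hw1)
  rw [map_add, hpar, parity_single, if_pos (Set.mem_univ _)] at hpar1
  exact absurd hpar1 (by decide)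

end MixedGraph

namespace MixedGraph
variable {V : Type*} {G : MixedGraph V} {u v : V} {P C : List (EdgeStep V (MixedEdge V))}

/-! ### From cycles of `G` to cycles of the augmented graph -/

lemma EdgeOf.unique {x : ℤˣ × Sym2 G.AugVertex} {e e' : MixedEdge V} (h : EdgeOf x e)
    (h' : EdgeOf x e') : e = e' := by
  have hmix : ∀ (y : Sym2 V) (t), Sum.inr t ∉ y.map (Sum.inl : V → G.AugVertex) := by
    intro y t ht
    obtain ⟨a, -, ha⟩ := Sym2.mem_map.mp ht
    cases ha
  rcases h with ⟨σ, y, rfl, rfl⟩ | ⟨t, rfl, h⟩ <;> rcases h' with ⟨τ, z, rfl, h'⟩ | ⟨t', rfl, h'⟩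
  · obtain ⟨h1, h2⟩ := Prod.ext_iff.mp h'
    rw [show σ = τ from h1, Sym2.map.injective Sum.inl_injective h2]
  · refine absurd (?_ : Sum.inr t' ∈ y.map Sum.inl) (hmix y t')
    rcases h' with h' | h' <;> rw [show y.map Sum.inl = _ from congrArg Prod.snd h'] <;>
      simp [negEdge, posEdge]
  · refine absurd (?_ : Sum.inr t ∈ z.map Sum.inl) (hmix z t)
    rcases h with h | h <;> rw [← show x.2 = z.map Sum.inl from congrArg Prod.snd h', h] <;>
      simp [negEdge, posEdge]
  · have h1 : Sum.inr t ∈ x.2 := by rcases h with rfl | rfl <;> simp [negEdge, posEdge]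
    have h2 : t = t' := by
      rcases h' with rfl | rfl <;> simpa [negEdge, posEdge, -Subtype.mk.injEq] using h1
    rw [h2]

/-- The steps in the augmented graph that replace the step `s`. -/
inductive Expands (G : MixedGraph V) : EdgeStep V (MixedEdge V) →
    List (EdgeStep G.AugVertex (ℤˣ × Sym2 G.AugVertex)) → Prop
  | signed (σ : ℤˣ) (i j : V) (h : MixedEdge.signed σ s(i, j) ∈ G.edges) :
      Expands G ⟨i, .signed σ s(i, j), j⟩ [⟨Sum.inl i, (σ, s(Sum.inl i, Sum.inl j)), Sum.inl j⟩]
  | forward (t : {p : V × V // MixedEdge.directed p.1 p.2 ∈ G.edges}) :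
      Expands G ⟨t.1.1, .directed t.1.1 t.1.2, t.1.2⟩
        [⟨Sum.inl t.1.1, negEdge t, Sum.inr t⟩, ⟨Sum.inr t, posEdge t, Sum.inl t.1.2⟩]
  | backward (t : {p : V × V // MixedEdge.directed p.1 p.2 ∈ G.edges}) :
      Expands G ⟨t.1.2, .directed t.1.1 t.1.2, t.1.1⟩
        [⟨Sum.inl t.1.2, posEdge t, Sum.inr t⟩, ⟨Sum.inr t, negEdge t, Sum.inl t.1.1⟩]

lemma exists_expands {s : EdgeStep V (MixedEdge V)} (he : s.edge ∈ G.edges)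
    (hends : s.edge.ends = s(s.src, s.tgt)) : ∃ L, Expands G s L := by
  obtain ⟨i, e, j⟩ := s
  cases e with
  | signed σ y =>
    obtain rfl : y = s(i, j) := hends
    exact ⟨_, .signed σ i j he⟩
  | directed a b =>
    rcases Sym2.eq_iff.mp hends with ⟨h1, h2⟩ | ⟨h1, h2⟩
    · obtain rfl : a = i := h1
      obtain rfl : b = j := h2
      exact ⟨_, .forward ⟨(a, b), he⟩⟩
    · obtain rfl : a = j := h1
      obtain rfl : b = i := h2
      exact ⟨_, .backward ⟨(a, b), he⟩⟩

open Classical in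
/-- The steps of the augmented graph that replace a step of `G`. -/
def expandStep (G : MixedGraph V) (s : EdgeStep V (MixedEdge V)) :
    List (EdgeStep G.AugVertex (ℤˣ × Sym2 G.AugVertex)) :=
  if h : ∃ L, Expands G s L then h.choose else []

/-- The walk of the augmented graph that replaces a walk of `G`. -/
def expand (G : MixedGraph V) (P : List (EdgeStep V (MixedEdge V))) :
    List (EdgeStep G.AugVertex (ℤˣ × Sym2 G.AugVertex)) := P.flatMap G.expandStep

lemma expands_expandStep {s : EdgeStep V (MixedEdge V)} (he : s.edge ∈ G.edges)
    (hends : s.edge.ends = s(s.src, s.tgt)) : Expands G s (G.expandStep s) := by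
  have h := exists_expands he hends
  rw [expandStep, dif_pos h]
  exact h.choose_spec

lemma negEdge_mem (t : {p : V × V // MixedEdge.directed p.1 p.2 ∈ G.edges}) :
    negEdge t ∈ G.augmented.edges :=
  mem_augmented_edges.mpr ⟨_, t.2, Or.inr ⟨t, rfl, Or.inl rfl⟩⟩

lemma posEdge_mem (t : {p : V × V // MixedEdge.directed p.1 p.2 ∈ G.edges}) :
    posEdge t ∈ G.augmented.edges :=
  mem_augmented_edges.mpr ⟨_, t.2, Or.inr ⟨t, rfl, Or.inr rfl⟩⟩

lemma Expands.isEdgeWalk {s L} (h : Expands G s L) :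
    IsEdgeWalk Prod.snd G.augmented.edges (Sum.inl s.src) L (Sum.inl s.tgt) := by
  cases h with
  | signed σ i j h =>
    exact ⟨rfl, mem_augmented_edges.mpr ⟨_, h, Or.inl ⟨σ, _, rfl, rfl⟩⟩, rfl, rfl⟩
  | forward t => exact ⟨rfl, negEdge_mem t, rfl, rfl, posEdge_mem t, rfl, rfl⟩
  | backward t =>
    exact ⟨rfl, posEdge_mem t, Sym2.eq_swap, rfl, negEdge_mem t, Sym2.eq_swap, rfl⟩

lemma Expands.odd_length {s L} (h : Expands G s L) (P : List (EdgeStep V (MixedEdge V))) {n : ℕ}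
    (hn : Odd n ↔ Odd (signedCount P)) :
    Odd (L.length + n) ↔ Odd (signedCount (s :: P)) := by
  cases h with
  | signed σ i j h =>
    rw [signedCount_cons_signed (s := ⟨i, .signed σ s(i, j), j⟩) rfl, List.length_singleton,
      add_comm, Nat.odd_add_one, Nat.odd_add_one, hn]
  | forward t =>
    rw [signedCount_cons_directed (s := ⟨_, .directed t.1.1 t.1.2, _⟩) rfl, ← hn]
    simp only [List.length_cons, List.length_nil]
    rw [Nat.odd_iff, Nat.odd_iff]
    omega
  | backward t =>
    rw [signedCount_cons_directed (s := ⟨_, .directed t.1.1 t.1.2, _⟩) rfl, ← hn]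
    simp only [List.length_cons, List.length_nil]
    rw [Nat.odd_iff, Nat.odd_iff]
    omega

lemma Expands.src {s L} (h : Expands G s L) : (L.map EdgeStep.src).Nodup ∧
    Sum.inl s.src ∈ L.map EdgeStep.src ∧
    ∀ x ∈ L.map EdgeStep.src, x = Sum.inl s.src ∨
      ∃ t : {p : V × V // MixedEdge.directed p.1 p.2 ∈ G.edges},
        x = Sum.inr t ∧ s.edge = .directed t.1.1 t.1.2 := by
  cases h with
  | signed => simp
  | forward t => simpa using t.2
  | backward t => simpa using t.2

lemma Expands.edge {s L} (h : Expands G s L) : (L.map EdgeStep.edge).Nodup ∧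
    ∀ x ∈ L.map EdgeStep.edge, EdgeOf x s.edge := by
  cases h with
  | signed σ i j h =>
    refine ⟨by simp, fun x hx => ?_⟩
    rw [List.map_singleton, List.mem_singleton] at hx
    exact Or.inl ⟨σ, _, rfl, hx⟩
  | forward t =>
    refine ⟨by simp [negEdge, posEdge], fun x hx => ?_⟩
    simp only [List.map_cons, List.map_nil, List.mem_cons, List.not_mem_nil, or_false] at hx
    exact Or.inr ⟨t, rfl, hx⟩
  | backward t =>
    refine ⟨by simp [negEdge, posEdge], fun x hx => ?_⟩
    simp only [List.map_cons, List.map_nil, List.mem_cons, List.not_mem_nil, or_false] at hx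
    exact Or.inr ⟨t, rfl, hx.symm⟩

lemma isEdgeWalk_expand (h : IsEdgeWalk MixedEdge.ends G.edges u P v) :
    IsEdgeWalk Prod.snd G.augmented.edges (Sum.inl u) (G.expand P) (Sum.inl v) := by
  induction P generalizing u with
  | nil =>
    obtain rfl : u = v := h
    rfl
  | cons s P ih =>
    obtain ⟨rfl, he, hends, hw⟩ := h
    exact isEdgeWalk_append.mpr ⟨_, (expands_expandStep he hends).isEdgeWalk, ih hw⟩

lemma odd_length_expand (h : IsEdgeWalk MixedEdge.ends G.edges u P v) :
    Odd (G.expand P).length ↔ Odd (signedCount P) := by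
  induction P generalizing u with
  | nil => rfl
  | cons s P ih =>
    obtain ⟨rfl, he, hends, hw⟩ := h
    rw [expand, List.flatMap_cons, List.length_append]
    exact (expands_expandStep he hends).odd_length P (ih hw)

/-- Each new edge and each artificial vertex determines the edge of G it comes from, so expansions
of different steps of a cycle share neither sources nor edges. -/
lemma isEdgeCycle_expand (h : IsEdgeCycle MixedEdge.ends G.edges u C) :
    IsEdgeCycle Prod.snd G.augmented.edges (Sum.inl u) (G.expand C) := by
  have hex : ∀ s ∈ C, Expands G s (G.expandStep s) := fun s hs =>
    expands_expandStep (h.2.1.step_mem hs).1 (h.2.1.step_mem hs).2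
  have hpw : C.Pairwise fun s t => s.src ≠ t.src ∧ s.edge ≠ t.edge :=
    (List.pairwise_map.mp h.2.2.1).and (List.pairwise_map.mp h.2.2.2)
  refine ⟨?_, isEdgeWalk_expand h.2.1, ?_, ?_⟩
  · obtain ⟨hne, hw, -⟩ := h
    cases C with
    | nil => exact absurd rfl hne
    | cons s C =>
      intro h0
      have h1 := (hex s (by simp)).src.2.1
      rw [expand, List.flatMap_cons, List.append_eq_nil_iff] at h0
      simp [h0.1] at h1
  · rw [expand, List.map_flatMap, List.nodup_flatMap]
    refine ⟨fun s hs => (hex s hs).src.1, hpw.imp_of_mem fun {s t} hs ht hst => ?_⟩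
    intro x hx hx'
    rcases (hex s hs).src.2.2 x hx with rfl | ⟨a, rfl, ha⟩ <;>
      rcases (hex t ht).src.2.2 _ hx' with h' | ⟨b, h', hb⟩
    · exact hst.1 (Sum.inl_injective h')
    · cases h'
    · cases h'
    · obtain rfl := Sum.inr_injective h'
      exact hst.2 (ha.trans hb.symm)
  · rw [expand, List.map_flatMap, List.nodup_flatMap]
    refine ⟨fun s hs => (hex s hs).edge.1, hpw.imp_of_mem fun {s t} hs ht hst => ?_⟩
    intro x hx hx'
    exact hst.2 (((hex s hs).edge.2 x hx).unique ((hex t ht).edge.2 x hx'))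

/-- The vertices of `G` near a vertex of the augmented graph. -/
def near (x : G.AugVertex) : Set V :=
  match x with
  | Sum.inl v => {v}
  | Sum.inr t => {t.1.1, t.1.2}

/-- An artificial vertex on the expansion comes from a directed edge of the cycle, both of whose
ends lie on the cycle. A walk may thus be trimmed to either end. -/
lemma near_subset (h : IsEdgeCycle MixedEdge.ends G.edges u C) {x : G.AugVertex}
    (hx : x ∈ cycleVertices (G.expand C)) : near x ⊆ cycleVertices C := by
  rw [cycleVertices, Set.mem_ofPred_eq, expand, List.map_flatMap, List.mem_flatMap] at hx
  obtain ⟨s, hs, hx⟩ := hx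
  rcases (expands_expandStep (h.2.1.step_mem hs).1 (h.2.1.step_mem hs).2).src.2.2 x hx with
    rfl | ⟨t, rfl, ht⟩
  · rintro _ rfl
    exact List.mem_map_of_mem hs
  · intro v hv
    refine h.mem_of_mem_ends hs ?_
    rw [ht]
    exact Sym2.mem_iff.mpr hv

lemma near_nonempty (x : G.AugVertex) : (near x).Nonempty := by
  rcases x with v | t
  · exact ⟨v, rfl⟩
  · exact ⟨t.1.1, Or.inl rfl⟩

/-! ### From alternating walks of the augmented graph to alternating walks of `G` -/

lemma augmented_edge_inl {x : ℤˣ × Sym2 G.AugVertex} {y : G.AugVertex}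
    (hx : x ∈ G.augmented.edges) (hy : x.2 = s(Sum.inl u, y)) :
    (∃ w, y = Sum.inl w ∧ MixedEdge.signed x.1 s(u, w) ∈ G.edges) ∨
    ∃ t, y = Sum.inr t ∧ (x.1 = -1 ∧ u = t.1.1 ∨ x.1 = 1 ∧ u = t.1.2) := by
  obtain ⟨e, he, ⟨σ, z, rfl, rfl⟩ | ⟨t, rfl, rfl | rfl⟩⟩ := mem_augmented_edges.mp hx
  · left
    induction z using Sym2.inductionOn with
    | hf i j =>
      rw [Sym2.map_mk] at hy
      rcases Sym2.eq_iff.mp hy with ⟨h1, h2⟩ | ⟨h1, h2⟩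
      · exact ⟨j, h2.symm, Sum.inl_injective h1 ▸ he⟩
      · refine ⟨i, h1.symm, ?_⟩
        obtain rfl := Sum.inl_injective h2
        have hs : s(j, i) = s(i, j) := Sym2.eq_swap
        simpa [hs] using he
  · right
    rcases Sym2.eq_iff.mp hy with ⟨h1, h2⟩ | ⟨h1, h2⟩
    · exact ⟨t, h2.symm, Or.inl ⟨rfl, (Sum.inl_injective h1).symm⟩⟩
    · cases h2
  · right
    rcases Sym2.eq_iff.mp hy with ⟨h1, h2⟩ | ⟨h1, h2⟩
    · cases h1
    · exact ⟨t, h1.symm, Or.inr ⟨rfl, (Sum.inl_injective h2).symm⟩⟩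

lemma augmented_edge_inr {x : ℤˣ × Sym2 G.AugVertex} {y : G.AugVertex}
    {t : {p : V × V // MixedEdge.directed p.1 p.2 ∈ G.edges}}
    (hx : x ∈ G.augmented.edges) (hy : x.2 = s(Sum.inr t, y)) :
    x.1 = -1 ∧ y = Sum.inl t.1.1 ∨ x.1 = 1 ∧ y = Sum.inl t.1.2 := by
  obtain ⟨e, he, ⟨σ, z, rfl, rfl⟩ | ⟨t', rfl, rfl | rfl⟩⟩ := mem_augmented_edges.mp hx
  · have : Sum.inr t ∈ z.map (Sum.inl : V → G.AugVertex) := by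
      rw [show z.map Sum.inl = _ from hy]; simp
    obtain ⟨a, -, ha⟩ := Sym2.mem_map.mp this
    cases ha
  · rcases Sym2.eq_iff.mp hy with ⟨h1, h2⟩ | ⟨h1, h2⟩
    · cases h1
    · obtain rfl := Sum.inr_injective h2
      exact Or.inl ⟨rfl, h1.symm⟩
  · rcases Sym2.eq_iff.mp hy with ⟨h1, h2⟩ | ⟨h1, h2⟩
    · obtain rfl := Sum.inr_injective h1
      exact Or.inr ⟨rfl, h2.symm⟩
    · cases h2

/-- Alternation forbids turning back at an artificial vertex, so a passage through it traverses the
whole directed edge. This consumes two steps, hence strong induction on length; the clause on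
initial signs glues the pieces. -/
lemma contract_inl (n : ℕ) {Q : List (EdgeStep G.AugVertex (ℤˣ × Sym2 G.AugVertex))}
    (hn : Q.length ≤ n) {y : G.AugVertex}
    (hQ : IsEdgeWalk Prod.snd G.augmented.edges (Sum.inl u) Q y) (halt : IsSignAlternating Q) :
    ∃ v ∈ near y, ∃ P, IsEdgeWalk MixedEdge.ends G.edges u P v ∧ IsAlternating P ∧
      ∀ s ∈ P.head?, ∃ q ∈ Q.head?, srcSign s = q.edge.1 := by
  induction n using Nat.strong_induction_on generalizing u Q with
  | _ n ih =>
  cases Q with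
  | nil =>
    obtain rfl : Sum.inl u = y := hQ
    exact ⟨u, rfl, [], rfl, List.isChain_nil, by simp⟩
  | cons p Q =>
    obtain ⟨psrc, pe, ptgt⟩ := p
    obtain ⟨h1, hmem, hends, hw⟩ := hQ
    obtain rfl : psrc = Sum.inl u := h1
    rcases augmented_edge_inl hmem hends with ⟨w, h2, hG⟩ | ⟨t, h2, hs⟩
    · obtain rfl : ptgt = Sum.inl w := h2
      obtain ⟨v, hv, P, hP, hPalt, hhead⟩ := ih Q.length (by simp at hn; omega)
        le_rfl hw (List.IsChain.tail halt)
      refine ⟨v, hv, ⟨u, .signed pe.1 s(u, w), w⟩ :: P, ⟨rfl, hG, rfl, hP⟩,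
        List.isChain_cons.mpr ⟨fun s hs => ?_, hPalt⟩, ?_⟩
      · obtain ⟨q, hq, hq'⟩ := hhead s hs
        have h3 := (List.isChain_cons.mp halt).1 q.edge.1
          (by rw [List.head?_map]; exact Option.mem_map_of_mem _ hq)
        rw [tgtSign_signed (s := ⟨u, .signed pe.1 s(u, w), w⟩) rfl, hq']
        exact Int.units_ne_iff_eq_neg.mp h3
      · rintro _ ⟨⟩
        exact ⟨_, rfl, rfl⟩
    · obtain rfl : ptgt = Sum.inr t := h2
      cases Q with
      | nil =>
        obtain rfl : Sum.inr t = y := hw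
        -- The walk stops at the artificial vertex: its last half-edge is dropped, and `u` is an end
        -- of that directed edge.
        refine ⟨u, ?_, [], rfl, List.isChain_nil, by simp⟩
        rcases hs with ⟨-, rfl⟩ | ⟨-, rfl⟩
        · exact Or.inl rfl
        · exact Or.inr rfl
      | cons p' Q =>
        obtain ⟨psrc', pe', ptgt'⟩ := p'
        obtain ⟨h1, hmem', hends', hw'⟩ := hw
        obtain rfl : psrc' = Sum.inr t := h1
        have hne : pe.1 ≠ pe'.1 := (List.isChain_cons_cons.mp halt).1
        have halt' := List.IsChain.tail halt
        have hlen : Q.length < n := by simp at hn; omega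
        rcases hs with ⟨hs, rfl⟩ | ⟨hs, rfl⟩ <;>
          rcases augmented_edge_inr hmem' hends' with ⟨hs', h3⟩ | ⟨hs', h3⟩
        · exact absurd (hs.trans hs'.symm) hne
        · obtain rfl : ptgt' = Sum.inl t.1.2 := h3
          obtain ⟨v, hv, P, hP, hPalt, hhead⟩ := ih Q.length hlen le_rfl hw' (List.IsChain.tail halt')
          have hfw : EdgeStep.IsForward ⟨t.1.1, .directed t.1.1 t.1.2, t.1.2⟩ := rfl
          refine ⟨v, hv, ⟨t.1.1, .directed t.1.1 t.1.2, t.1.2⟩ :: P, ⟨rfl, t.2, rfl, hP⟩,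
            List.isChain_cons.mpr ⟨fun s hs => ?_, hPalt⟩, ?_⟩
          · obtain ⟨q, hq, hq'⟩ := hhead s hs
            have h3 := (List.isChain_cons.mp halt').1 q.edge.1
              (by rw [List.head?_map]; exact Option.mem_map_of_mem _ hq)
            rw [tgtSign_forward hfw, hq', ← hs']
            exact Int.units_ne_iff_eq_neg.mp h3
          · rintro _ ⟨⟩
            exact ⟨_, rfl, (srcSign_forward hfw).trans hs.symm⟩
        · obtain rfl : ptgt' = Sum.inl t.1.1 := h3
          obtain ⟨v, hv, P, hP, hPalt, hhead⟩ := ih Q.length hlen le_rfl hw' (List.IsChain.tail halt')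
          have hbw : EdgeStep.IsBackward ⟨t.1.2, .directed t.1.1 t.1.2, t.1.1⟩ := rfl
          refine ⟨v, hv, ⟨t.1.2, .directed t.1.1 t.1.2, t.1.1⟩ :: P, ⟨rfl, t.2, Sym2.eq_swap, hP⟩,
            List.isChain_cons.mpr ⟨fun s hs => ?_, hPalt⟩, ?_⟩
          · obtain ⟨q, hq, hq'⟩ := hhead s hs
            have h3 := (List.isChain_cons.mp halt').1 q.edge.1
              (by rw [List.head?_map]; exact Option.mem_map_of_mem _ hq)
            rw [tgtSign_backward (G := G) t.2 hbw, hq', ← hs']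
            exact Int.units_ne_iff_eq_neg.mp h3
          · rintro _ ⟨⟩
            exact ⟨_, rfl, (srcSign_backward (G := G) t.2 hbw).trans hs.symm⟩
        · exact absurd (hs.trans hs'.symm) hne

lemma contract {Q : List (EdgeStep G.AugVertex (ℤˣ × Sym2 G.AugVertex))} {x y : G.AugVertex}
    (hQ : IsEdgeWalk Prod.snd G.augmented.edges x Q y) (halt : IsSignAlternating Q) :
    ∃ u ∈ near x, ∃ v ∈ near y, ∃ P, IsEdgeWalk MixedEdge.ends G.edges u P v ∧
      IsAlternating P := by
  rcases x with u | t
  · obtain ⟨v, hv, P, hP, hPalt, -⟩ := contract_inl _ le_rfl hQ halt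
    exact ⟨u, rfl, v, hv, P, hP, hPalt⟩
  · cases Q with
    | nil =>
      obtain rfl : Sum.inr t = y := hQ
      exact ⟨t.1.1, Or.inl rfl, t.1.1, Or.inl rfl, [], rfl, List.isChain_nil⟩
    | cons p Q =>
      obtain ⟨psrc, pe, ptgt⟩ := p
      obtain ⟨h1, hmem, hends, hw⟩ := hQ
      obtain rfl : psrc = Sum.inr t := h1
      rcases augmented_edge_inr hmem hends with ⟨-, h⟩ | ⟨-, h⟩
      · obtain rfl : ptgt = Sum.inl t.1.1 := h
        obtain ⟨v, hv, P, hP, hPalt, -⟩ := contract_inl _ le_rfl hw (List.IsChain.tail halt)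
        exact ⟨_, Or.inl rfl, v, hv, P, hP, hPalt⟩
      · obtain rfl : ptgt = Sum.inl t.1.2 := h
        obtain ⟨v, hv, P, hP, hPalt, -⟩ := contract_inl _ le_rfl hw (List.IsChain.tail halt)
        exact ⟨_, Or.inr rfl, v, hv, P, hP, hPalt⟩

/-- A directed step reverses the sign and the meeting condition reverses it again, so the required
sign passes unchanged to the next signed edge. -/
lemma IsAlternating.signs (h : IsAlternating P) :
    (P.filterMap fun s => s.edge.sign?).IsChain (· ≠ ·) ∧
      ∀ σ ∈ (P.filterMap fun s => s.edge.sign?).head?, ∀ s ∈ P.head?, srcSign s = σ := by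
  induction P with
  | nil => simp
  | cons s P ih =>
    obtain ⟨h1, h2⟩ := ih (List.IsChain.tail h)
    have hnext := (List.isChain_cons.mp h).1
    have hP : ∀ σ ∈ (P.filterMap fun s => s.edge.sign?).head?, tgtSign s = -σ := by
      intro σ hσ
      cases P with
      | nil => simp at hσ
      | cons t P => rw [hnext t rfl, h2 σ hσ t rfl]
    cases hs : s.edge with
    | signed τ y =>
      have : (s :: P).filterMap (fun s => s.edge.sign?) =
          τ :: P.filterMap fun s => s.edge.sign? :=
        List.filterMap_cons_some (by rw [hs]; rfl)
      rw [this]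
      refine ⟨List.isChain_cons.mpr ⟨fun σ hσ => ?_, h1⟩, ?_⟩
      · rw [← tgtSign_signed hs]
        exact Int.units_ne_iff_eq_neg.mpr (hP σ hσ)
      · rintro _ ⟨⟩ _ ⟨⟩
        exact srcSign_signed hs
    | directed i j =>
      have : (s :: P).filterMap (fun s => s.edge.sign?) = P.filterMap fun s => s.edge.sign? :=
        List.filterMap_cons_none (by rw [hs]; rfl)
      rw [this]
      refine ⟨h1, ?_⟩
      rintro σ hσ _ ⟨⟩
      have := hP σ hσ
      rw [tgtSign_directed hs] at this
      exact neg_injective this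

/-- The outgoing sign flips after every signed step and is kept after every directed one. This is
the source of the parity conditions between directed edges. -/
lemma IsAlternating.srcSign_last {d d' : EdgeStep V (MixedEdge V)}
    {M : List (EdgeStep V (MixedEdge V))} (h : IsAlternating (d :: (M ++ [d']))) :
    srcSign d' = -tgtSign d * (-1) ^ signedCount M := by
  induction M generalizing d with
  | nil =>
    have : tgtSign d = -srcSign d' := (List.isChain_cons_cons.mp h).1
    rw [this]; simp
  | cons m M ih =>
    obtain ⟨h1, h2⟩ := List.isChain_cons_cons.mp h
    rw [ih h2, h1]
    cases hm : m.edge with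
    | signed σ y =>
      rw [signedCount_cons_signed hm, tgtSign_signed hm, srcSign_signed hm, pow_succ]
      simp
    | directed i j =>
      rw [signedCount_cons_directed hm, tgtSign_directed hm]

lemma odd_of_neg_one_pow {n : ℕ} (h : ((-1) ^ n : ℤˣ) = -1) : Odd n := by
  by_contra hn
  rw [(Nat.not_odd_iff_even.mp hn).neg_one_pow] at h
  exact absurd h (by decide)

lemma even_of_neg_one_pow {n : ℕ} (h : ((-1) ^ n : ℤˣ) = 1) : Even n := by
  by_contra hn
  rw [(Nat.not_even_iff_odd.mp hn).neg_one_pow] at h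
  exact absurd h (by decide)

lemma isGenAlternating_of_isAlternating (hw : IsEdgeWalk MixedEdge.ends G.edges u P v)
    (h : IsAlternating P) : IsGenAlternating P := by
  have hedge : ∀ {L : List (EdgeStep V (MixedEdge V))} {s}, L <:+: P → s ∈ L → s.edge ∈ G.edges :=
    fun hL hs => (hw.step_mem (hL.mem hs)).1
  have hpair : ∀ {s t : EdgeStep V (MixedEdge V)}, [s, t] <:+: P → tgtSign s = -srcSign t :=
    fun hst => (List.isChain_cons_cons.mp (List.IsChain.infix h hst)).1
  have hsign : ∀ {s : EdgeStep V (MixedEdge V)} {σ}, s.edge.sign? = some σ →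
      srcSign s = σ ∧ tgtSign s = σ := by
    intro s σ hs
    cases he : s.edge with
    | signed τ y =>
      rw [he] at hs
      obtain rfl : τ = σ := by simpa [MixedEdge.sign?] using hs
      exact ⟨srcSign_signed he, tgtSign_signed he⟩
    | directed i j => rw [he] at hs; cases hs
  refine ⟨h.signs.1, ?_, ?_, ?_, ?_, ?_, ?_⟩
  · intro s d σ hinf hd hs
    have := hpair hinf
    rwa [(hsign hs).2, srcSign_forward hd, neg_neg] at this
  · intro d s σ hinf hd hs
    have := hpair hinf
    rw [(hsign hs).1, tgtSign_forward hd] at this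
    rw [this, neg_neg]
  · intro s d σ hinf hd hs
    have := hpair hinf
    rwa [(hsign hs).2, srcSign_backward (hedge hinf (by simp)) hd] at this
  · intro d s σ hinf hd hs
    have := hpair hinf
    rw [(hsign hs).1, tgtSign_backward (hedge hinf (by simp)) hd] at this
    exact (neg_injective this).symm
  · intro d M d' hinf hd
    have := IsAlternating.srcSign_last (List.IsChain.infix h hinf)
    apply odd_of_neg_one_pow
    rcases hd with ⟨h1, h2⟩ | ⟨h1, h2⟩
    · rw [tgtSign_forward h1, srcSign_backward (hedge hinf (by simp)) h2] at this
      rw [neg_mul, one_mul] at this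
      exact (neg_eq_iff_eq_neg.mp this.symm)
    · rw [tgtSign_backward (hedge hinf (by simp)) h1, srcSign_forward h2] at this
      rw [neg_neg, one_mul] at this
      exact this.symm
  · intro d M d' hinf hd
    have := IsAlternating.srcSign_last (List.IsChain.infix h hinf)
    apply even_of_neg_one_pow
    rcases hd with ⟨h1, h2⟩ | ⟨h1, h2⟩
    · rw [tgtSign_forward h1, srcSign_forward h2] at this
      rw [neg_mul, one_mul] at this
      exact (neg_injective this).symm
    · rw [tgtSign_backward (hedge hinf (by simp)) h1,
        srcSign_backward (hedge hinf (by simp)) h2] at this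
      rw [neg_neg, one_mul] at this
      exact this.symm

theorem genOddCycleCondition_of_augmented (hG : G.augmented.OddCycleCondition) :
    G.GenOddCycleCondition := by
  intro u u' C C' hC hC' hodd hodd'
  rcases hG _ _ _ _ (isEdgeCycle_expand hC) (isEdgeCycle_expand hC')
    ((odd_length_expand hC.2.1).mpr hodd) ((odd_length_expand hC'.2.1).mpr hodd') with
    h | ⟨x, hx, hx'⟩ | ⟨x, hx, y, hy, Q, hQ, halt⟩
  · left
    rintro ⟨P, hP⟩
    exact h ⟨_, isEdgeWalk_expand hP⟩
  · right; left
    obtain ⟨i, hi⟩ := near_nonempty x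
    exact ⟨i, near_subset hC hx hi, near_subset hC' hx' hi⟩
  · right; right
    obtain ⟨i, hi, j, hj, P, hP, hPalt⟩ := contract hQ halt
    exact ⟨i, near_subset hC hx hi, j, near_subset hC' hy hj, P, hP,
      isGenAlternating_of_isAlternating hP hPalt⟩

end MixedGraph

/-! ### The circle of implications and quadratic monomial subrings. -/

namespace MixedGraph

theorem isIntegrallyClosed_iff (k : Type*) [Field k] {V : Type*} [Finite V] (G : MixedGraph V) :
    (IsIntegrallyClosed (G.edgeRing k) ↔ G.augmented.OddCycleCondition) ∧
    (IsIntegrallyClosed (G.edgeRing k) ↔ G.GenOddCycleCondition) := by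
  rw [isIntegrallyClosed_edgeRing_iff]
  exact ⟨⟨augmented_oddCycleCondition_of_isSaturated,
      fun h => isSaturated_of_genOddCycleCondition (genOddCycleCondition_of_augmented h)⟩,
    fun h => genOddCycleCondition_of_augmented (augmented_oddCycleCondition_of_isSaturated h),
    isSaturated_of_genOddCycleCondition⟩

end MixedGraph

theorem eq_edgeRing_graphOfSubring {k V : Type*} [Field k] {R : Subalgebra k (MvLaurent k V)}
    (hR : IsQuadraticMonomialGenerated R) : R = (graphOfSubring R).edgeRing k := by
  obtain ⟨S, hS, hRS⟩ := hR
  apply le_antisymm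
  · conv_lhs => rw [hRS]
    refine Algebra.adjoin_le fun x hx => ?_
    obtain ⟨e, rfl⟩ := hS hx
    have hmem : e.monomial k ∈ R := by rw [hRS]; exact Algebra.subset_adjoin hx
    by_cases he : ∃ i, e = MixedEdge.directed i i
    · obtain ⟨i, rfl⟩ := he
      -- A degenerate generator is the trivial monomial, so its absence from the graph loses
      -- nothing.
      have : (MixedEdge.directed i i).monomial k = 1 := by
        rw [MixedEdge.monomial, MixedEdge.rho, sub_self]; rfl
      rw [this]
      exact one_mem _
    · exact Algebra.subset_adjoin ⟨e, ⟨hmem, fun i h => he ⟨i, h⟩⟩, rfl⟩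
  · refine Algebra.adjoin_le ?_
    rintro _ ⟨e, he, rfl⟩
    exact he.1

end

/-- For a mixed signed, directed graph `G` on a finite vertex set, the edge ring `k[G]` is normal
iff the augmented signed graph satisfies the odd cycle condition, and iff `G` satisfies the
generalized odd cycle condition; every quadratic-monomial generated subring of a Laurent polynomial
ring is the edge ring of its graph, so its normality is characterized in this way. -/
theorem theoremA (k : Type*) [Field k] (V : Type*) [Finite V] :
    (∀ G : MixedGraph V,
      (IsIntegrallyClosed (G.edgeRing k) ↔ G.augmented.OddCycleCondition) ∧
      (IsIntegrallyClosed (G.edgeRing k) ↔ G.GenOddCycleCondition)) ∧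
    (∀ R : Subalgebra k (MvLaurent k V), IsQuadraticMonomialGenerated R →
      R = (graphOfSubring R).edgeRing k ∧
      (IsIntegrallyClosed R ↔ (graphOfSubring R).augmented.OddCycleCondition) ∧
      (IsIntegrallyClosed R ↔ (graphOfSubring R).GenOddCycleCondition)) := by
  refine ⟨fun G => G.isIntegrallyClosed_iff k, fun R hR => ?_⟩
  have h := eq_edgeRing_graphOfSubring hR
  have h' := (graphOfSubring R).isIntegrallyClosed_iff k
  rw [← h] at h'
  exact ⟨h, h'⟩
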